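/- All graphs are finite, simple, undirected and have at least one vertex; graphs and families of graphs are considered up to isomorphism. For non-adjacent distinct vertices $a,b$ of a graph $G$, an $a,b$-separator is a set $S\subseteq V(G)\setminus\{a,b\}$ such that $a$ and $b$ lie in different components of $G-S$; a minimal separator of $G$ is an inclusion-minimal $a,b$-separator for some such pair $a,b$. Let $s(G)$ denote the number of minimal separators of $G$. A class $\mathcal{G}$ of graphs is tame if there is a polynomial $p:\mathbb{R}\to\mathbb{R}$ such that $s(G)\le p(|V(G)|)$ for all $G\in\mathcal{G}$. For a family $\mathcal{F}$ of graphs, a graph is $\mathcal{F}$-free if none of its induced subgraphs is isomorphic to a member of $\mathcal{F}$; write $\mathcal{F}\trianglelefteq\mathcal{F}'$ if every $\mathcal{F}$-free graph is $\mathcal{F}'$-free. Here $P_n$, $C_n$, $K_n$ are the path, cycle and complete graph on $n$ vertices, $+$ denotes disjoint union, $kG$ is the disjoint union of $k$ copies of $G$, the claw is $K_{1,3}$, the diamond is $K_4$ minus an edge, and the paw is a triangle with one pendant edge attached. **Theorem.** Let $\mathcal{F}$ be a family of graphs with at most four vertices such that $\mathcal{F}\neq\{4P_1,C_4\}$ and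 $\mathcal{F}\neq\{4P_1,\text{claw},C_4\}$. Then the class of $\mathcal{F}$-free graphs is tame if and only if $\mathcal{F}\trianglelefteq\mathcal{F}'$ for one of the following families $\mathcal{F}'$: 1. $\mathcal{F}'=\{P_4\}$ or $\mathcal{F}'=\{2P_2\}$; 2. $\mathcal{F}'=\{F,\text{paw}\}$ for some $F\in\{4P_1,\,P_2+2P_1,\,P_3+P_1,\,\text{claw}\}$; 3. $\mathcal{F}'=\{F,K_3+P_1\}$ for some $F\in\{4P_1,\,P_2+2P_1,\,P_3+P_1,\,\text{claw}\}$; 4. $\mathcal{F}'=\{F,K_4\}$ for some $F\in\{4P_1,\,P_2+2P_1,\,P_3+P_1\}$; 5. $\mathcal{F}'=\{F,C_4\}$ for some $F\in\{P_2+2P_1,\,P_3+P_1\}$; 6. $\mathcal{F}'=\{4P_1,C_4,\text{diamond}\}$. -/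

import Mathlib

namespace MinSep

/-- A finite, simple, undirected graph with at least one vertex. -/
structure FinGraph where
  /-- the vertex set -/
  V : Type
  [finite : Finite V]
  [nonempty : Nonempty V]
  /-- the adjacency relation -/
  graph : SimpleGraph V

attribute [instance] FinGraph.finite FinGraph.nonempty

/-- `S` is an `a,b`-separator of `G`: it avoids `a` and `b`, and `a` and `b` lie in different
connected components of `G - S`. -/
def IsSeparator {V : Type*} (G : SimpleGraph V) (a b : V) (S : Set V) : Prop :=
  ∃ (ha : a ∈ Sᶜ) (hb : b ∈ Sᶜ), ¬ (G.induce Sᶜ).Reachable ⟨a, ha⟩ ⟨b, hb⟩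

/-- `S` is a minimal separator of `G`: an inclusion-minimal `a,b`-separator for some pair of
distinct non-adjacent vertices `a`, `b`. -/
def IsMinimalSeparator {V : Type*} (G : SimpleGraph V) (S : Set V) : Prop :=
  ∃ a b : V, a ≠ b ∧ ¬ G.Adj a b ∧ Minimal (IsSeparator G a b) S

/-- The number `s(G)` of minimal separators of `G`. -/
noncomputable def numMinSep (G : FinGraph) : ℕ :=
  {S : Set G.V | IsMinimalSeparator G.graph S}.ncard

/-- A graph class is tame if the number of minimal separators of its members is bounded by
a real polynomial in the number of vertices. -/
def Tame (𝒢 : Set FinGraph) : Prop :=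
  ∃ p : Polynomial ℝ, ∀ G ∈ 𝒢, (numMinSep G : ℝ) ≤ p.eval (Nat.card G.V : ℝ)

/-- The class of `ℱ`-free graphs: no induced subgraph is isomorphic to a member of `ℱ`. -/
def freeClass (ℱ : Set FinGraph) : Set FinGraph :=
  {G | ∀ F ∈ ℱ, ¬ F.graph.IsIndContained G.graph}

/-- `ℱ ⊴ ℱ'`: every `ℱ`-free graph is `ℱ'`-free. -/
def FreeLE (ℱ ℱ' : Set FinGraph) : Prop :=
  freeClass ℱ ⊆ freeClass ℱ'

/-- Two families of graphs are equal up to isomorphism of their members. -/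
def SameFamily (ℱ ℱ' : Set FinGraph) : Prop :=
  (∀ G ∈ ℱ, ∃ H ∈ ℱ', Nonempty (G.graph ≃g H.graph)) ∧
    ∀ H ∈ ℱ', ∃ G ∈ ℱ, Nonempty (G.graph ≃g H.graph)

/-- `P₄`, the path on four vertices. -/
def P4 : FinGraph := ⟨Fin 4, SimpleGraph.pathGraph 4⟩

/-- `2P₂`, the disjoint union of two edges. -/
def twoP2 : FinGraph :=
  ⟨Fin 2 ⊕ Fin 2, SimpleGraph.sum (SimpleGraph.pathGraph 2) (SimpleGraph.pathGraph 2)⟩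

/-- `4P₁`, the edgeless graph on four vertices. -/
def fourP1 : FinGraph := ⟨Fin 4, ⊥⟩

/-- `P₂ + 2P₁`. -/
def P2add2P1 : FinGraph :=
  ⟨Fin 2 ⊕ Fin 2, SimpleGraph.sum (SimpleGraph.pathGraph 2) ⊥⟩

/-- `P₃ + P₁`. -/
def P3addP1 : FinGraph :=
  ⟨Fin 3 ⊕ Fin 1, SimpleGraph.sum (SimpleGraph.pathGraph 3) ⊥⟩

/-- The claw `K_{1,3}`. -/
def claw : FinGraph := ⟨Fin 1 ⊕ Fin 3, completeBipartiteGraph (Fin 1) (Fin 3)⟩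

/-- `K₃ + P₁`. -/
def K3addP1 : FinGraph := ⟨Fin 3 ⊕ Fin 1, SimpleGraph.sum ⊤ ⊥⟩

/-- The complete graph `K₄`. -/
def K4 : FinGraph := ⟨Fin 4, ⊤⟩

/-- The cycle `C₄`. -/
def C4 : FinGraph := ⟨Fin 4, SimpleGraph.cycleGraph 4⟩

/-- The diamond: `K₄` minus an edge. -/
def diamond : FinGraph := ⟨Fin 4, (⊤ : SimpleGraph (Fin 4)).deleteEdges {s(0, 1)}⟩

/-- The paw: a triangle `0, 1, 2` with a pendant edge from `2` to `3`. -/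
def paw : FinGraph :=
  ⟨Fin 4, SimpleGraph.fromEdgeSet {s(0, 1), s(1, 2), s(0, 2), s(2, 3)}⟩

/-- The list of maximal tame families. -/
def IsListed (ℱ' : Set FinGraph) : Prop :=
  (ℱ' = {P4} ∨ ℱ' = {twoP2}) ∨
  (∃ F ∈ ({fourP1, P2add2P1, P3addP1, claw} : Set FinGraph), ℱ' = {F, paw}) ∨
  (∃ F ∈ ({fourP1, P2add2P1, P3addP1, claw} : Set FinGraph), ℱ' = {F, K3addP1}) ∨
  (∃ F ∈ ({fourP1, P2add2P1, P3addP1} : Set FinGraph), ℱ' = {F, K4}) ∨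
  (∃ F ∈ ({P2add2P1, P3addP1} : Set FinGraph), ℱ' = {F, C4}) ∨
  ℱ' = {fourP1, C4, diamond}

end MinSep

/-! Tameness. A minimal separator `S` leaves two components `A`, `B` of `G - S` that each see all of
`S` (`FullPair`). Call `S` determined by a vertex set `X` if membership in `S` depends only on
adjacency and equality to the vertices of `X`. For fixed `K` only polynomially many sets are
determined by at most `K` vertices (`ncard_determinedBy_le`), so it suffices to bound `X` uniformly
on each listed class. There are three basic sources of a bounded `X`: a bounded full component,
since its outside neighbourhood is `S`; bounded subsets of `A` and of `B` that both dominate `S`,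
since a vertex with neighbours on both sides lies in `S`; and a bounded `S`. The case `{4P₁, C₄,
diamond}` combines several such vertex sets.

Necessity. Joining two copies of a graph by a matching of size `k` yields `2 ^ k` minimal
separators, one for each choice of an endpoint of every matching edge, under a mild connectivity
condition (`isMinimalSeparator_transversal`). The graphs `theta`, `prism` and `ladderLineGraph`
arise in this way and have linearly many vertices. If the `ℱ`-free graphs are tame, then for each of
the three sequences some member of `ℱ` embeds in a four-vertex induced subgraph of one of its
graphs, and few four-vertex graphs occur there.

Suppose no listed family lies above `ℱ`. Then `theta` forces `ℱ` below one of `4P₁`, `P₂ + 2P₁`, `P₃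
+ P₁`, claw, which excludes paw and `K₃ + P₁`. Now `prism` forces `C₄` or `K₄`, and
`ladderLineGraph` forces one of `4P₁`, `P₂ + 2P₁`, `P₃ + P₁`. This excludes `K₄`, so `C₄` is forced;
that excludes `P₂ + 2P₁` and `P₃ + P₁`, so `4P₁` is forced, and the diamond is excluded. Only `4P₁`,
`C₄` and possibly the claw can be members of `ℱ`: the two exceptional families. -/

namespace MinSep
set_option linter.unusedSimpArgs false
open SimpleGraph

/-! ### Induced subgraphs on four vertices. -/

section FourVertex

variable {V W : Type*} {G : SimpleGraph V}

theorem isIndContained_of_map {H : SimpleGraph W} (f : W → V)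
    (h : ∀ x y, x ≠ y → f x ≠ f y ∧ (G.Adj (f x) (f y) ↔ H.Adj x y)) : H.IsIndContained G := by
  refine ⟨⟨⟨f, fun x y hxy => ?_⟩, ?_⟩⟩
  · by_contra hne
    exact (h x y hne).1 hxy
  · intro x y
    by_cases hxy : x = y
    · subst hxy; simp
    · exact (h x y hxy).2

/-- The adjacency matrix of a graph on `Fin 4`, in terms of its six entries above the diagonal. -/
def adjTable (b01 b02 b03 b12 b13 b23 : Bool) (i j : Fin 4) : Bool :=
  match i, j with
  | 0, 1 | 1, 0 => b01
  | 0, 2 | 2, 0 => b02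
  | 0, 3 | 3, 0 => b03
  | 1, 2 | 2, 1 => b12
  | 1, 3 | 3, 1 => b13
  | 2, 3 | 3, 2 => b23
  | _, _ => false

/-- Adjacency tables of representatives of the eleven graphs on four vertices. -/
def fourVertexTables : List (Bool × Bool × Bool × Bool × Bool × Bool) :=
  [(false, false, false, false, false, false),
   (true, false, false, false, false, false),
   (true, false, false, false, false, true),
   (true, false, false, true, false, false),
   (true, true, true, false, false, false),
   (true, false, false, true, false, true),
   (true, true, false, true, false, false),
   (true, false, true, true, false, true),
   (true, true, false, true, false, true),
   (false, true, true, true, true, true),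
   (true, true, true, true, true, true)]

/-- An exhaustive check over the 64 labelled graphs. The representatives are labelled so that their
entries match the hypotheses of the embedding lemmas below. -/
theorem exists_mem_fourVertexTables : ∀ b01 b02 b03 b12 b13 b23 : Bool,
    ∃ t ∈ fourVertexTables, ∃ i j k l : Fin 4, (i ≠ j ∧ i ≠ k ∧ i ≠ l ∧ j ≠ k ∧ j ≠ l ∧ k ≠ l) ∧
      adjTable b01 b02 b03 b12 b13 b23 i j = t.1 ∧ adjTable b01 b02 b03 b12 b13 b23 i k = t.2.1 ∧
      adjTable b01 b02 b03 b12 b13 b23 i l = t.2.2.1 ∧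
      adjTable b01 b02 b03 b12 b13 b23 j k = t.2.2.2.1 ∧
      adjTable b01 b02 b03 b12 b13 b23 j l = t.2.2.2.2.1 ∧
      adjTable b01 b02 b03 b12 b13 b23 k l = t.2.2.2.2.2 := by
  decide +kernel

variable {a b c d : V}

theorem P4_isIndContained (hab : G.Adj a b) (hbc : G.Adj b c) (hcd : G.Adj c d)
    (hac : ¬ G.Adj a c) (had : ¬ G.Adj a d) (hbd : ¬ G.Adj b d) : P4.graph.IsIndContained G := by
  have h1 : a ≠ c := by rintro rfl; exact had hcd
  have h2 : a ≠ d := by rintro rfl; exact hac hcd.symm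
  have h3 : b ≠ d := by rintro rfl; exact had hab
  change IsIndContained (pathGraph 4) G
  refine isIndContained_of_map (![a, b, c, d] : Fin 4 → V) ?_
  intro x y
  fin_cases x <;> fin_cases y <;>
    simp [pathGraph_adj, hab, hbc, hcd, hac, had, hbd, h1, h2, h3, h1.symm, h2.symm, h3.symm,
      hab.ne, hbc.ne, hcd.ne, hab.ne', hbc.ne', hcd.ne', G.adj_comm b a, G.adj_comm c b,
      G.adj_comm d c, G.adj_comm c a, G.adj_comm d a, G.adj_comm d b]

theorem C4_isIndContained (hab : G.Adj a b) (hbc : G.Adj b c) (hcd : G.Adj c d) (hda : G.Adj d a)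
    (hac : ¬ G.Adj a c) (hbd : ¬ G.Adj b d) (h1 : a ≠ c) (h2 : b ≠ d) :
    C4.graph.IsIndContained G := by
  change IsIndContained (cycleGraph 4) G
  refine isIndContained_of_map (![a, b, c, d] : Fin 4 → V) ?_
  intro x y
  fin_cases x <;> fin_cases y <;>
    simp [cycleGraph_adj, hab, hbc, hcd, hac, hda, hbd, h1, h2, h1.symm, h2.symm,
      hab.ne, hbc.ne, hcd.ne, hab.ne', hbc.ne', hcd.ne', hda.ne, hda.ne', G.adj_comm b a,
      G.adj_comm c b, G.adj_comm d c, G.adj_comm c a, G.adj_comm a d, G.adj_comm d b] <;> decide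

theorem twoP2_isIndContained (hab : G.Adj a b) (hcd : G.Adj c d) (hac : ¬ G.Adj a c)
    (had : ¬ G.Adj a d) (hbc : ¬ G.Adj b c) (hbd : ¬ G.Adj b d) :
    twoP2.graph.IsIndContained G := by
  have h1 : a ≠ c := by rintro rfl; exact had hcd
  have h2 : a ≠ d := by rintro rfl; exact hac hcd.symm
  have h3 : b ≠ d := by rintro rfl; exact had hab
  have h4 : b ≠ c := by rintro rfl; exact hac hab
  change IsIndContained (SimpleGraph.sum (pathGraph 2) (pathGraph 2)) G
  refine isIndContained_of_map (Sum.elim ![a, b] ![c, d] : Fin 2 ⊕ Fin 2 → V) ?_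
  rintro (x | x) (y | y) <;>
  fin_cases x <;> fin_cases y <;>
    simp [pathGraph_adj, hab, hbc, hcd, hac, had, hbd, h1, h2, h3, h4, h1.symm, h2.symm,
      h3.symm, h4.symm, hab.ne, hcd.ne, hab.ne', hcd.ne', G.adj_comm b a, G.adj_comm c b,
      G.adj_comm d c, G.adj_comm c a, G.adj_comm d a, G.adj_comm d b]

theorem fourP1_isIndContained (hab : ¬ G.Adj a b) (hac : ¬ G.Adj a c) (had : ¬ G.Adj a d)
    (hbc : ¬ G.Adj b c) (hbd : ¬ G.Adj b d) (hcd : ¬ G.Adj c d) (h1 : a ≠ b) (h2 : a ≠ c)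
    (h3 : a ≠ d) (h4 : b ≠ c) (h5 : b ≠ d) (h6 : c ≠ d) : fourP1.graph.IsIndContained G := by
  change IsIndContained ((⊥ : SimpleGraph (Fin 4))) G
  refine isIndContained_of_map (![a, b, c, d] : Fin 4 → V) ?_
  intro x y
  fin_cases x <;> fin_cases y <;>
    simp [hab, hbc, hcd, hac, had, hbd, h1, h2, h3, h4, h5, h6, h1.symm, h2.symm, h3.symm,
      h4.symm, h5.symm, h6.symm, G.adj_comm b a, G.adj_comm c b, G.adj_comm d c, G.adj_comm c a,
      G.adj_comm d a, G.adj_comm d b]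

theorem P2add2P1_isIndContained (hab : G.Adj a b) (hac : ¬ G.Adj a c) (had : ¬ G.Adj a d)
    (hbc : ¬ G.Adj b c) (hbd : ¬ G.Adj b d) (hcd : ¬ G.Adj c d) (h6 : c ≠ d) :
    P2add2P1.graph.IsIndContained G := by
  have h1 : a ≠ c := by rintro rfl; exact hbc hab.symm
  have h2 : a ≠ d := by rintro rfl; exact hbd hab.symm
  have h3 : b ≠ d := by rintro rfl; exact had hab
  have h4 : b ≠ c := by rintro rfl; exact hac hab
  change IsIndContained (SimpleGraph.sum (pathGraph 2) (⊥ : SimpleGraph (Fin 2))) G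
  refine isIndContained_of_map (Sum.elim ![a, b] ![c, d] : Fin 2 ⊕ Fin 2 → V) ?_
  rintro (x | x) (y | y) <;>
  fin_cases x <;> fin_cases y <;>
    simp [pathGraph_adj, hab, hbc, hcd, hac, had, hbd, h1, h2, h3, h4, h1.symm, h2.symm,
      h3.symm, h4.symm, hab.ne, h6, hab.ne', h6.symm, G.adj_comm b a, G.adj_comm c b,
      G.adj_comm d c, G.adj_comm c a, G.adj_comm d a, G.adj_comm d b]

theorem P3addP1_isIndContained (hab : G.Adj a b) (hbc : G.Adj b c) (hac : ¬ G.Adj a c)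
    (had : ¬ G.Adj a d) (hbd : ¬ G.Adj b d) (hcd : ¬ G.Adj c d) (h6 : a ≠ c) :
    P3addP1.graph.IsIndContained G := by
  have h1 : b ≠ d := by rintro rfl; exact had hab
  have h2 : a ≠ d := by rintro rfl; exact hbd hab.symm
  have h3 : c ≠ d := by rintro rfl; exact hbd hbc
  change IsIndContained (SimpleGraph.sum (pathGraph 3) (⊥ : SimpleGraph (Fin 1))) G
  refine isIndContained_of_map (Sum.elim ![a, b, c] ![d] : Fin 3 ⊕ Fin 1 → V) ?_
  rintro (x | x) (y | y) <;>
  fin_cases x <;> fin_cases y <;>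
    simp [pathGraph_adj, hab, hbc, hcd, hac, had, hbd, h1, h2, h3, h1.symm, h2.symm,
      h3.symm, hab.ne, h6, hab.ne', hbc.ne, hbc.ne', h6.symm, G.adj_comm b a, G.adj_comm c b,
      G.adj_comm d c, G.adj_comm c a, G.adj_comm d a, G.adj_comm d b]

theorem claw_isIndContained (hab : G.Adj a b) (hac : G.Adj a c) (had : G.Adj a d)
    (hbc : ¬ G.Adj b c) (hbd : ¬ G.Adj b d) (hcd : ¬ G.Adj c d) (h1 : b ≠ c) (h2 : b ≠ d)
    (h3 : c ≠ d) : claw.graph.IsIndContained G := by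
  change IsIndContained (completeBipartiteGraph (Fin 1) (Fin 3)) G
  refine isIndContained_of_map (Sum.elim ![a] ![b, c, d] : Fin 1 ⊕ Fin 3 → V) ?_
  rintro (x | x) (y | y) <;>
  fin_cases x <;> fin_cases y <;>
    simp [hab, hbc, hcd, hac, had, hbd, h1, h2, h3, h1.symm, h2.symm,
      h3.symm, hab.ne, hab.ne', hac.ne, hac.ne', had.ne, had.ne', G.adj_comm b a, G.adj_comm c b,
      G.adj_comm d c, G.adj_comm c a, G.adj_comm d a, G.adj_comm d b]

theorem K3addP1_isIndContained (hab : G.Adj a b) (hac : G.Adj a c) (hbc : G.Adj b c)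
    (had : ¬ G.Adj a d) (hbd : ¬ G.Adj b d) (hcd : ¬ G.Adj c d) :
    K3addP1.graph.IsIndContained G := by
  have h1 : b ≠ d := by rintro rfl; exact had hab
  have h2 : a ≠ d := by rintro rfl; exact hbd hab.symm
  have h3 : c ≠ d := by rintro rfl; exact hbd hbc
  change IsIndContained (SimpleGraph.sum (⊤ : SimpleGraph (Fin 3)) (⊥ : SimpleGraph (Fin 1))) G
  refine isIndContained_of_map (Sum.elim ![a, b, c] ![d] : Fin 3 ⊕ Fin 1 → V) ?_
  rintro (x | x) (y | y) <;>
  fin_cases x <;> fin_cases y <;>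
    simp [hab, hbc, hcd, hac, had, hbd, h1, h2, h3, h1.symm, h2.symm,
      h3.symm, hab.ne, hab.ne', hbc.ne, hbc.ne', hac.ne, hac.ne', G.adj_comm b a, G.adj_comm c b,
      G.adj_comm d c, G.adj_comm c a, G.adj_comm d a, G.adj_comm d b]

theorem paw_isIndContained (hab : G.Adj a b) (hac : G.Adj a c) (hbc : G.Adj b c)
    (hcd : G.Adj c d) (had : ¬ G.Adj a d) (hbd : ¬ G.Adj b d) : paw.graph.IsIndContained G := by
  have h1 : b ≠ d := by rintro rfl; exact had hab
  have h2 : a ≠ d := by rintro rfl; exact hbd hab.symm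
  change IsIndContained (fromEdgeSet ({s(0, 1), s(1, 2), s(0, 2), s(2, 3)} : Set (Sym2 (Fin 4)))) G
  refine isIndContained_of_map (![a, b, c, d] : Fin 4 → V) ?_
  intro x y
  fin_cases x <;> fin_cases y <;>
    simp [hab, hbc, hcd, hac, had, hbd, h1, h2, h1.symm, h2.symm, hcd.ne, hcd.ne',
      hab.ne, hab.ne', hbc.ne, hbc.ne', hac.ne, hac.ne', G.adj_comm b a, G.adj_comm c b,
      G.adj_comm d c, G.adj_comm c a, G.adj_comm d a, G.adj_comm d b]

theorem diamond_isIndContained (hab : ¬ G.Adj a b) (hac : G.Adj a c) (had : G.Adj a d)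
    (hbc : G.Adj b c) (hbd : G.Adj b d) (hcd : G.Adj c d) (h1 : a ≠ b) :
    diamond.graph.IsIndContained G := by
  change IsIndContained ((⊤ : SimpleGraph (Fin 4)).deleteEdges {s(0, 1)}) G
  refine isIndContained_of_map (![a, b, c, d] : Fin 4 → V) ?_
  intro x y
  fin_cases x <;> fin_cases y <;>
    simp [hab, hbc, hcd, hac, had, hbd, h1, h1.symm, hcd.ne, hcd.ne',
      had.ne, had.ne', hbc.ne, hbc.ne', hac.ne, hac.ne', hbd.ne, hbd.ne',
      G.adj_comm b a, G.adj_comm c b,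
      G.adj_comm d c, G.adj_comm c a, G.adj_comm d a, G.adj_comm d b]

theorem K4_isIndContained (hab : G.Adj a b) (hac : G.Adj a c) (had : G.Adj a d)
    (hbc : G.Adj b c) (hbd : G.Adj b d) (hcd : G.Adj c d) : K4.graph.IsIndContained G := by
  change IsIndContained ((⊤ : SimpleGraph (Fin 4))) G
  refine isIndContained_of_map (![a, b, c, d] : Fin 4 → V) ?_
  intro x y
  fin_cases x <;> fin_cases y <;>
    simp [hab, hbc, hcd, hac, had, hbd, hcd.ne, hcd.ne',
      had.ne, had.ne', hbc.ne, hbc.ne', hac.ne, hac.ne', hbd.ne, hbd.ne', hab.ne, hab.ne',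
      G.adj_comm b a, G.adj_comm c b,
      G.adj_comm d c, G.adj_comm c a, G.adj_comm d a, G.adj_comm d b]

/-- The eleven graphs on four vertices. -/
def fourVertexGraphs : Set FinGraph :=
  {fourP1, P2add2P1, twoP2, P3addP1, claw, P4, K3addP1, C4, paw, diamond, K4}

theorem card_of_mem_fourVertexGraphs {H : FinGraph} (hH : H ∈ fourVertexGraphs) :
    Nat.card H.V = 4 := by
  rcases hH with rfl | rfl | rfl | rfl | rfl | rfl | rfl | rfl | rfl | rfl | rfl <;>
    simp [fourP1, P2add2P1, twoP2, P3addP1, claw, P4, K3addP1, C4, paw, diamond, K4]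

theorem exists_isIndContained_of_four (v : Fin 4 → V) (hv : Function.Injective v) :
    ∃ H ∈ fourVertexGraphs, H.graph.IsIndContained G := by
  classical
  obtain ⟨t, ht, i, j, k, l, ⟨n1, n2, n3, n4, n5, n6⟩, e1, e2, e3, e4, e5, e6⟩ :=
    exists_mem_fourVertexTables (G.Adj (v 0) (v 1)) (G.Adj (v 0) (v 2)) (G.Adj (v 0) (v 3))
      (G.Adj (v 1) (v 2)) (G.Adj (v 1) (v 3)) (G.Adj (v 2) (v 3))
  have key : ∀ x y : Fin 4, adjTable (G.Adj (v 0) (v 1)) (G.Adj (v 0) (v 2)) (G.Adj (v 0) (v 3))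
      (G.Adj (v 1) (v 2)) (G.Adj (v 1) (v 3)) (G.Adj (v 2) (v 3)) x y =
        decide (G.Adj (v x) (v y)) := by
    intro x y
    fin_cases x <;> fin_cases y <;>
      first | (simp [adjTable]; done) | (simp [adjTable]; exact G.adj_comm _ _)
  rw [key] at e1 e2 e3 e4 e5 e6
  simp only [fourVertexTables, List.mem_cons, List.not_mem_nil, or_false] at ht
  unfold fourVertexGraphs
  rcases ht with rfl | rfl | rfl | rfl | rfl | rfl | rfl | rfl | rfl | rfl | rfl <;>
    simp only [decide_eq_true_eq, decide_eq_false_iff_not] at e1 e2 e3 e4 e5 e6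
  · exact ⟨fourP1, by simp, fourP1_isIndContained e1 e2 e3 e4 e5 e6 (hv.ne n1) (hv.ne n2)
      (hv.ne n3) (hv.ne n4) (hv.ne n5) (hv.ne n6)⟩
  · exact ⟨P2add2P1, by simp, P2add2P1_isIndContained e1 e2 e3 e4 e5 e6 (hv.ne n6)⟩
  · exact ⟨twoP2, by simp, twoP2_isIndContained e1 e6 e2 e3 e4 e5⟩
  · exact ⟨P3addP1, by simp, P3addP1_isIndContained e1 e4 e2 e3 e5 e6 (hv.ne n2)⟩
  · exact ⟨claw, by simp, claw_isIndContained e1 e2 e3 e4 e5 e6 (hv.ne n4) (hv.ne n5) (hv.ne n6)⟩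
  · exact ⟨P4, by simp, P4_isIndContained e1 e4 e6 e2 e3 e5⟩
  · exact ⟨K3addP1, by simp, K3addP1_isIndContained e1 e2 e4 e3 e5 e6⟩
  · exact ⟨C4, by simp, C4_isIndContained e1 e4 e6 e3.symm e2 e5 (hv.ne n2) (hv.ne n5)⟩
  · exact ⟨paw, by simp, paw_isIndContained e1 e2 e4 e6 e3 e5⟩
  · exact ⟨diamond, by simp, diamond_isIndContained e1 e2 e3 e4 e5 e6 (hv.ne n1)⟩
  · exact ⟨K4, by simp, K4_isIndContained e1 e2 e3 e4 e5 e6⟩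

theorem exists_iso_of_card_eq [Finite V] [Finite W] {H : SimpleGraph W}
    (h : H.IsIndContained G) (hc : Nat.card V ≤ Nat.card W) : Nonempty (H ≃g G) := by
  obtain ⟨f⟩ := h
  have hcard : Nat.card V = Nat.card W := le_antisymm hc (Nat.card_le_card_of_injective f f.injective)
  exact ⟨⟨Equiv.ofBijective f ((Nat.bijective_iff_injective_and_card f).2 ⟨f.injective, hcard.symm⟩),
    f.map_rel_iff⟩⟩

/-- An induced subgraph on at most four vertices extends to one on exactly four vertices. -/
theorem exists_fourVertexGraph_between [Finite V] [Finite W] {F : SimpleGraph W}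
    (h : F.IsIndContained G) (hF : Nat.card W ≤ 4) (hG : 4 ≤ Nat.card V) :
    ∃ H ∈ fourVertexGraphs, F.IsIndContained H.graph ∧ H.graph.IsIndContained G := by
  classical
  have := Fintype.ofFinite V
  have := Fintype.ofFinite W
  obtain ⟨f⟩ := h
  obtain ⟨X, hX, hXc⟩ := Finset.exists_superset_card_eq (s := Finset.univ.image f) (n := 4)
    (by rw [Finset.card_image_of_injective _ f.injective]; simpa using hF) (by simpa using hG)
  let e : Fin 4 ≃ X := (Finset.equivFinOfCardEq hXc).symm
  obtain ⟨H, hH, hHX⟩ := exists_isIndContained_of_four (G := G.induce (X : Set V))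
    (fun i => e i) e.injective
  -- Both graphs have four vertices, so the embedding is an isomorphism and `F`, which lives inside
  -- `X`, transfers to `H`.
  have hiso := exists_iso_of_card_eq hHX (by
    rw [card_of_mem_fourVertexGraphs hH]; simp [hXc])
  obtain ⟨i⟩ := hiso
  refine ⟨H, hH, ?_, hHX.trans ⟨Embedding.induce _⟩⟩
  refine IsIndContained.trans (H := G.induce (X : Set V)) ?_ ⟨i.symm.toEmbedding⟩
  refine isIndContained_of_map (fun w => ⟨f w, hX (by simp)⟩) fun x y hxy => ⟨?_, ?_⟩
  · simpa [Subtype.ext_iff] using hxy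
  · simp

end FourVertex

/-! ### Full components of minimal separators, and counting sets determined by few vertices. -/

section FullPairs

variable {V : Type*} {G : SimpleGraph V} {S A B : Set V}

/-- `A` induces a connected (or empty) subgraph, expressed through propagation of properties along
edges inside `A`. -/
def PropagatesIn (G : SimpleGraph V) (A : Set V) : Prop :=
  ∀ p : V → Prop, (∃ x ∈ A, p x) → (∀ x ∈ A, p x → ∀ y ∈ A, G.Adj x y → p y) → ∀ y ∈ A, p y

/-- `A` and `B` are distinct components of `G - S`, both having all of `S` as neighbourhood. -/
structure FullPair (G : SimpleGraph V) (S A B : Set V) : Prop where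
  nonemptyA : A.Nonempty
  nonemptyB : B.Nonempty
  connA : PropagatesIn G A
  connB : PropagatesIn G B
  notMemA : ∀ s ∈ S, s ∉ A
  notMemB : ∀ s ∈ S, s ∉ B
  disj : ∀ a ∈ A, a ∉ B
  nbrA : ∀ a ∈ A, ∀ v, G.Adj a v → v ∈ A ∨ v ∈ S
  nbrB : ∀ b ∈ B, ∀ v, G.Adj b v → v ∈ B ∨ v ∈ S
  fullA : ∀ s ∈ S, ∃ a ∈ A, G.Adj s a
  fullB : ∀ s ∈ S, ∃ b ∈ B, G.Adj s b

namespace FullPair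

theorem symm (h : FullPair G S A B) : FullPair G S B A :=
  ⟨h.nonemptyB, h.nonemptyA, h.connB, h.connA, h.notMemB, h.notMemA,
    fun b hb ha => h.disj b ha hb, h.nbrB, h.nbrA, h.fullB, h.fullA⟩

theorem not_adj (h : FullPair G S A B) {a b : V} (ha : a ∈ A) (hb : b ∈ B) : ¬ G.Adj a b := by
  intro hab
  rcases h.nbrA a ha b hab with h1 | h1
  · exact h.disj b h1 hb
  · exact h.notMemB b h1 hb

theorem not_adj' (h : FullPair G S A B) {a b : V} (ha : a ∈ A) (hb : b ∈ B) : ¬ G.Adj b a :=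
  fun hab => h.not_adj ha hb hab.symm

theorem ne (h : FullPair G S A B) {a b : V} (ha : a ∈ A) (hb : b ∈ B) : a ≠ b := by
  rintro rfl
  exact h.disj _ ha hb

theorem ne_left (h : FullPair G S A B) {s a : V} (hs : s ∈ S) (ha : a ∈ A) : s ≠ a := by
  rintro rfl
  exact h.notMemA _ hs ha

theorem ne_right (h : FullPair G S A B) {s b : V} (hs : s ∈ S) (hb : b ∈ B) : s ≠ b :=
  h.symm.ne_left hs hb

end FullPair

theorem reachable_induct {W : Type*} {H : SimpleGraph W} {u v : W} (h : H.Reachable u v)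
    (p : W → Prop) (hu : p u) (hp : ∀ x y, H.Adj x y → p x → p y) : p v := by
  rw [reachable_iff_reflTransGen] at h
  induction h with
  | refl => exact hu
  | tail _ hab ih => exact hp _ _ hab ih

/-- The vertices reachable from `a` in `G - S`. -/
def side (G : SimpleGraph V) (S : Set V) (a : V) : Set V :=
  {v | ∃ (ha : a ∈ Sᶜ) (hv : v ∈ Sᶜ), (G.induce Sᶜ).Reachable ⟨a, ha⟩ ⟨v, hv⟩}

theorem mem_side_of_adj {a x y : V} (hx : x ∈ side G S a) (hxy : G.Adj x y) (hy : y ∉ S) :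
    y ∈ side G S a := by
  obtain ⟨ha, hx', hr⟩ := hx
  exact ⟨ha, hy, hr.trans (Adj.reachable (by simpa using hxy))⟩

theorem propagatesIn_side {a : V} : PropagatesIn G (side G S a) := by
  rintro p ⟨x, hx, hpx⟩ hp y hy
  obtain ⟨ha, hx', hr⟩ := hx
  obtain ⟨_, hy', hr'⟩ := hy
  -- Membership in the side is carried along with `p`, because `p` is only known to spread along
  -- edges inside the side.
  refine (reachable_induct (hr.symm.trans hr') (fun z => z.1 ∈ side G S a ∧ p z.1)
    ⟨⟨ha, hx', hr⟩, hpx⟩ ?_).2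
  rintro z w hzw ⟨hz, hpz⟩
  have hzw' : G.Adj z.1 w.1 := by simpa using hzw
  have hw := mem_side_of_adj hz hzw' w.2
  exact ⟨hw, hp _ hz hpz _ hw hzw'⟩

/-- If `s` had no neighbour in the component of `a`, returning `s` to the graph would not enlarge
that component, and `S \ {s}` would be a smaller separator. -/
theorem exists_adj_side {a b s : V} (h : Minimal (IsSeparator G a b) S) (hs : s ∈ S) :
    ∃ v ∈ side G S a, G.Adj s v := by
  by_contra! hcon
  obtain ⟨ha, hb, hnr⟩ := h.prop
  have hsep : IsSeparator G a b (S \ {s}) := by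
    refine ⟨fun h => ha h.1, fun h => hb h.1, fun hr => hnr ?_⟩
    have := reachable_induct hr (fun z => z.1 ∈ side G S a) ⟨ha, ha, Reachable.refl _⟩ ?_
    · obtain ⟨_, _, h⟩ := this
      exact h
    · intro x y hxy hx
      have hxy' : G.Adj x.1 y.1 := by simpa using hxy
      refine mem_side_of_adj hx hxy' fun hyS => ?_
      have hys : y.1 = s := by
        by_contra hne
        exact y.2 ⟨hyS, hne⟩
      rw [hys] at hxy'
      exact hcon _ hx hxy'.symm
  exact (h.le_of_le hsep Set.sdiff_subset hs).2 rfl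

theorem isSeparator_comm {a b : V} : IsSeparator G a b S ↔ IsSeparator G b a S :=
  ⟨fun ⟨ha, hb, h⟩ => ⟨hb, ha, fun h' => h h'.symm⟩, fun ⟨ha, hb, h⟩ => ⟨hb, ha, fun h' => h h'.symm⟩⟩

theorem IsMinimalSeparator.exists_fullPair (h : IsMinimalSeparator G S) :
    ∃ A B, FullPair G S A B := by
  obtain ⟨a, b, -, -, hmin⟩ := h
  have hmin' : Minimal (IsSeparator G b a) S := by
    have : IsSeparator G a b = IsSeparator G b a := funext fun S => propext isSeparator_comm
    rwa [this] at hmin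
  obtain ⟨ha, hb, hnr⟩ := hmin.prop
  refine ⟨side G S a, side G S b, ⟨a, ha, ha, .refl _⟩, ⟨b, hb, hb, .refl _⟩, propagatesIn_side,
    propagatesIn_side, ?_, ?_, ?_, ?_, ?_, fun s hs => exists_adj_side hmin hs,
    fun s hs => exists_adj_side hmin' hs⟩
  · rintro s hs ⟨_, h, _⟩; exact h hs
  · rintro s hs ⟨_, h, _⟩; exact h hs
  · rintro v ⟨_, _, h1⟩ ⟨_, _, h2⟩; exact hnr (h1.trans h2.symm)
  · intro x hx v hxv
    by_cases hv : v ∈ S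
    · exact Or.inr hv
    · exact Or.inl (mem_side_of_adj hx hxv hv)
  · intro x hx v hxv
    by_cases hv : v ∈ S
    · exact Or.inr hv
    · exact Or.inl (mem_side_of_adj hx hxv hv)

/-- Membership in `S` depends only on adjacency and equality to the vertices of `X`. -/
def DeterminedBy (G : SimpleGraph V) (X : Finset V) (S : Set V) : Prop :=
  ∀ v w, (∀ x ∈ X, (G.Adj v x ↔ G.Adj w x) ∧ (v = x ↔ w = x)) → v ∈ S → w ∈ S

/-- Such a set is recovered from a `K`-tuple listing `X` and from the set of adjacency/equality
patterns that its elements realise on the tuple. There are `4 ^ K` patterns, hence `2 ^ (4 ^ K)`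
sets of patterns. -/
theorem ncard_determinedBy_le [Finite V] [Nonempty V] (G : SimpleGraph V) (K : ℕ) :
    {S : Set V | ∃ X : Finset V, X.card ≤ K ∧ DeterminedBy G X S}.ncard ≤
      2 ^ (4 ^ K) * Nat.card V ^ K := by
  classical
  have := Fintype.ofFinite V
  let f : (Fin K → V) × Set (Fin K → Prop × Prop) → Set V := fun p =>
    {v | (fun i => (G.Adj v (p.1 i), v = p.1 i)) ∈ p.2}
  have hsub : {S : Set V | ∃ X : Finset V, X.card ≤ K ∧ DeterminedBy G X S} ⊆ Set.range f := by
    rintro S ⟨X, hX, hS⟩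
    obtain ⟨x, hx⟩ : ∃ x : Fin K → V, ∀ v ∈ X, ∃ i, x i = v := by
      -- When `X` has fewer than `K` elements the tuple is padded with an arbitrary vertex;
      -- repetitions are harmless.
      refine ⟨fun i => if h : i.1 < X.card then (X.equivFin.symm ⟨i.1, h⟩ : V)
        else Classical.arbitrary V, fun v hv => ?_⟩
      refine ⟨⟨(X.equivFin ⟨v, hv⟩).1, (X.equivFin ⟨v, hv⟩).2.trans_le hX⟩, ?_⟩
      simp
    refine ⟨(x, (fun v i => (G.Adj v (x i), v = x i)) '' S), ?_⟩
    ext w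
    simp only [f, Set.mem_ofPred_eq, Set.mem_image]
    constructor
    · rintro ⟨v, hv, hvw⟩
      refine hS v w (fun y hy => ?_) hv
      obtain ⟨i, rfl⟩ := hx y hy
      have := congrFun hvw i
      simp only [Prod.mk.injEq] at this
      exact ⟨iff_of_eq this.1, iff_of_eq this.2⟩
    · intro hw
      exact ⟨w, hw, rfl⟩
  calc _ ≤ (Set.range f).ncard := Set.ncard_le_ncard hsub (Set.toFinite _)
    _ ≤ Nat.card ((Fin K → V) × Set (Fin K → Prop × Prop)) := by
        rw [← Set.image_univ, ← Set.ncard_univ]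
        exact Set.ncard_image_le (Set.toFinite _)
    _ = 2 ^ (4 ^ K) * Nat.card V ^ K := by
        simp [Nat.card_eq_fintype_card, mul_comm, Fintype.card_prod]

theorem tame_of_determinedBy {𝒢 : Set FinGraph} (K : ℕ)
    (h : ∀ G ∈ 𝒢, ∀ S A B, FullPair G.graph S A B →
      ∃ X : Finset G.V, X.card ≤ K ∧ DeterminedBy G.graph X S) : Tame 𝒢 := by
  refine ⟨Polynomial.C (2 ^ (4 ^ K)) * Polynomial.X ^ K, fun G hG => ?_⟩
  have h1 : numMinSep G ≤ 2 ^ (4 ^ K) * Nat.card G.V ^ K := by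
    refine le_trans (Set.ncard_le_ncard ?_ (Set.toFinite _)) (ncard_determinedBy_le G.graph K)
    intro S hS
    obtain ⟨A, B, hAB⟩ := IsMinimalSeparator.exists_fullPair hS
    exact h G hG S A B hAB
  simpa using (by exact_mod_cast h1 :
    (numMinSep G : ℝ) ≤ 2 ^ (4 ^ K) * (Nat.card G.V : ℝ) ^ K)

namespace FullPair

/-- Take `X = A`. A vertex with the same pattern as some `v ∈ S` has a neighbour in `A`, so it lies
in `A` or in `S`; the equality part of the pattern rules out `A`. -/
theorem determinedBy_of_card_le [Finite V] (h : FullPair G S A B) {K : ℕ} (hA : A.ncard ≤ K) :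
    ∃ X : Finset V, X.card ≤ K ∧ DeterminedBy G X S := by
  classical
  have hfin : A.Finite := Set.toFinite A
  refine ⟨hfin.toFinset, by rwa [← Set.ncard_eq_toFinset_card A hfin], fun v w hvw hv => ?_⟩
  simp only [Set.Finite.mem_toFinset] at hvw
  obtain ⟨a, ha, hva⟩ := h.fullA v hv
  have hwa := ((hvw a ha).1.1 hva).symm
  refine (h.nbrA a ha w hwa).resolve_left fun hw => ?_
  exact h.notMemA v hv (((hvw w hw).2.2 rfl) ▸ hw)

/-- Having a neighbour in `A₀` and one in `B₀` forces a vertex into `S`, because `A` and `B` are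
distinct components of `G - S`. -/
theorem determinedBy_of_dominating (h : FullPair G S A B) {A₀ B₀ : Finset V} {K L : ℕ}
    (hA₀ : ∀ a ∈ A₀, a ∈ A) (hB₀ : ∀ b ∈ B₀, b ∈ B) (hA : ∀ s ∈ S, ∃ a ∈ A₀, G.Adj s a)
    (hB : ∀ s ∈ S, ∃ b ∈ B₀, G.Adj s b) (hK : A₀.card ≤ K) (hL : B₀.card ≤ L) :
    ∃ X : Finset V, X.card ≤ K + L ∧ DeterminedBy G X S := by
  classical
  refine ⟨A₀ ∪ B₀, (Finset.card_union_le _ _).trans (by omega), fun v w hvw hv => ?_⟩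
  obtain ⟨a, ha, hva⟩ := hA v hv
  obtain ⟨b, hb, hvb⟩ := hB v hv
  have hwa := ((hvw a (by simp [ha])).1.1 hva).symm
  have hwb := ((hvw b (by simp [hb])).1.1 hvb).symm
  rcases h.nbrA a (hA₀ a ha) w hwa with h1 | h1
  · exact absurd hwb (h.not_adj' h1 (hB₀ b hb))
  · exact h1

theorem determinedBy_of_ncard_separator_le [Finite V] {K : ℕ} (hS : S.ncard ≤ K) :
    ∃ X : Finset V, X.card ≤ K ∧ DeterminedBy G X S := by
  have hfin : S.Finite := Set.toFinite S
  refine ⟨hfin.toFinset, by rwa [← Set.ncard_eq_toFinset_card S hfin], fun v w hvw hv => ?_⟩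
  have := (hvw v (by simpa using hv)).2.1 rfl
  rwa [this]

end FullPair

end FullPairs

/-! ### Bounds from full components that are cliques or triangle-free. -/

section Cliques

variable {V : Type*} {G : SimpleGraph V} {S A B : Set V}

theorem exists_injective_of_le_ncard {n : ℕ} [Finite V] (h : n ≤ A.ncard) :
    ∃ v : Fin n → V, Function.Injective v ∧ ∀ i, v i ∈ A := by
  obtain ⟨B, hBA, hB⟩ := Set.exists_subset_card_eq h
  have hf := Set.toFinite B
  have hc : hf.toFinset.card = n := by rw [← Set.ncard_eq_toFinset_card B hf, hB]
  let e := (Finset.equivFinOfCardEq hc).symm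
  refine ⟨fun i => (e i : V), fun i j hij => e.injective (Subtype.ext hij), fun i => hBA ?_⟩
  exact hf.mem_toFinset.1 (e i).2

theorem exists_mem_notMem_of_card_lt [Finite V] {X : Finset V} (h : X.card < A.ncard) :
    ∃ a ∈ A, a ∉ X := by
  obtain ⟨a, ha, haX⟩ := Set.exists_mem_notMem_of_ncard_lt_ncard (s := (X : Set V)) (t := A)
    (by simpa using h)
  exact ⟨a, ha, by simpa using haX⟩

theorem PropagatesIn.exists_adj (h : PropagatesIn G A) {a a' : V} (ha : a ∈ A) (ha' : a' ∈ A)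
    (hne : a ≠ a') : ∃ x ∈ A, G.Adj a x := by
  by_contra! hcon
  refine hne (h (fun z => z = a) ⟨a, ha, rfl⟩ ?_ a' ha').symm
  rintro x hx rfl y hy hxy
  exact absurd hxy (hcon y hy)

/-- Without an induced path on three vertices, the property of being equal or adjacent to `x`
spreads along edges, so every vertex of `A` would be adjacent to all others. -/
theorem PropagatesIn.exists_inducedPath (h : PropagatesIn G A) (hA : ¬ G.IsClique A) :
    ∃ u ∈ A, ∃ v ∈ A, ∃ w ∈ A, G.Adj u v ∧ G.Adj v w ∧ ¬ G.Adj u w ∧ u ≠ w := by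
  by_contra! hcon
  refine hA fun x hx y hy hxy => ?_
  have := h (fun z => z = x ∨ G.Adj x z) ⟨x, hx, Or.inl rfl⟩ ?_ y hy
  · exact this.resolve_left hxy.symm
  · rintro u hu (rfl | hxu) v hv huv
    · exact Or.inr huv
    · by_cases hxv : x = v
      · exact Or.inl hxv.symm
      · by_contra hcon'
        push Not at hcon'
        exact hxv (hcon x hx u hu v hv hxu huv hcon'.2)

theorem ncard_clique_le_of_K4_free [Finite V] (hF : ¬ K4.graph.IsIndContained G)
    (hA : G.IsClique A) : A.ncard ≤ 3 := by
  by_contra! hlt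
  obtain ⟨v, hv, hvA⟩ := exists_injective_of_le_ncard (n := 4) hlt
  have key : ∀ i j, i ≠ j → G.Adj (v i) (v j) := fun i j hij => hA (hvA i) (hvA j) (hv.ne hij)
  exact hF (K4_isIndContained (key 0 1 (by decide)) (key 0 2 (by decide)) (key 0 3 (by decide))
    (key 1 2 (by decide)) (key 1 3 (by decide)) (key 2 3 (by decide)))

namespace FullPair

/-- If `s` sees `x` but not its neighbour `y` in `A`, then a neighbour of `s` in `B` followed by `s,
x, y` is an induced `P₄`. Hence adjacency to `s` spreads over all of `A`, and a single vertex on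
each side dominates `S`. -/
theorem adj_of_P4_free (h : FullPair G S A B) (hF : ¬ P4.graph.IsIndContained G) {s a : V}
    (hs : s ∈ S) (ha : a ∈ A) : G.Adj s a := by
  refine h.connA (fun z => G.Adj s z) (h.fullA s hs) (fun x hx hsx y hy hxy => ?_) a ha
  by_contra hsy
  obtain ⟨b, hb, hsb⟩ := h.fullB s hs
  exact hF (P4_isIndContained hsb.symm hsx hxy (h.not_adj' hx hb) (h.not_adj' hy hb) hsy)

theorem determinedBy_of_P4_free (h : FullPair G S A B) (hF : ¬ P4.graph.IsIndContained G) :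
    ∃ X : Finset V, X.card ≤ 2 ∧ DeterminedBy G X S := by
  obtain ⟨a, ha⟩ := h.nonemptyA
  obtain ⟨b, hb⟩ := h.nonemptyB
  exact h.determinedBy_of_dominating (A₀ := {a}) (B₀ := {b}) (K := 1) (L := 1) (by simpa) (by simpa)
    (fun s hs => ⟨a, by simp, h.adj_of_P4_free hF hs ha⟩)
    (fun s hs => ⟨b, by simp, h.symm.adj_of_P4_free hF hs hb⟩) (by simp) (by simp)

theorem determinedBy_of_twoP2_free [Finite V] (h : FullPair G S A B)
    (hF : ¬ twoP2.graph.IsIndContained G) :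
    ∃ X : Finset V, X.card ≤ 1 ∧ DeterminedBy G X S := by
  by_cases hA : A.ncard ≤ 1
  · exact h.determinedBy_of_card_le hA
  by_cases hB : B.ncard ≤ 1
  · exact h.symm.determinedBy_of_card_le hB
  exfalso
  push Not at hA hB
  rw [Set.one_lt_ncard_iff] at hA hB
  obtain ⟨a, a', ha, ha', haa'⟩ := hA
  obtain ⟨b, b', hb, hb', hbb'⟩ := hB
  obtain ⟨x, hx, hax⟩ := h.connA.exists_adj ha ha' haa'
  obtain ⟨y, hy, hby⟩ := h.connB.exists_adj hb hb' hbb'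
  exact hF (twoP2_isIndContained hax hby (h.not_adj ha hb) (h.not_adj ha hy) (h.not_adj hx hb)
    (h.not_adj hx hy))

theorem isClique_of_P3addP1_free (h : FullPair G S A B) (hF : ¬ P3addP1.graph.IsIndContained G) :
    G.IsClique A := by
  by_contra hA
  obtain ⟨u, hu, v, hv, w, hw, huv, hvw, huw, hne⟩ := h.connA.exists_inducedPath hA
  obtain ⟨b, hb⟩ := h.nonemptyB
  exact hF (P3addP1_isIndContained huv hvw huw (h.not_adj hu hb) (h.not_adj hv hb)
    (h.not_adj hw hb) hne)

/-- A connected `B` with more than one vertex contains an edge, which completes a non-adjacent pair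
of `A` to `P₂ + 2P₁`. -/
theorem isClique_of_P2add2P1_free [Finite V] (h : FullPair G S A B)
    (hF : ¬ P2add2P1.graph.IsIndContained G) (hB : 1 < B.ncard) : G.IsClique A := by
  rw [Set.one_lt_ncard_iff] at hB
  obtain ⟨b, b', hb, hb', hbb'⟩ := hB
  obtain ⟨y, hy, hby⟩ := h.connB.exists_adj hb hb' hbb'
  intro x hx z hz hxz
  by_contra hadj
  exact hF (P2add2P1_isIndContained hby (h.not_adj' hx hb) (h.not_adj' hz hb) (h.not_adj' hx hy)
    (h.not_adj' hz hy) hadj hxz)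

/-- In a `{P₃ + P₁}`-free or `{P₂ + 2P₁}`-free graph, a full pair consists of cliques unless one of
its members is a single vertex. -/
theorem isClique_or_ncard_le [Finite V] (h : FullPair G S A B)
    (hF : ¬ P2add2P1.graph.IsIndContained G ∨ ¬ P3addP1.graph.IsIndContained G) :
    A.ncard ≤ 1 ∨ B.ncard ≤ 1 ∨ (G.IsClique A ∧ G.IsClique B) := by
  by_cases hA : A.ncard ≤ 1
  · exact Or.inl hA
  by_cases hB : B.ncard ≤ 1
  · exact Or.inr (Or.inl hB)
  push Not at hA hB
  rcases hF with hF | hF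
  · exact Or.inr (Or.inr ⟨h.isClique_of_P2add2P1_free hF hB, h.symm.isClique_of_P2add2P1_free hF hA⟩)
  · exact Or.inr (Or.inr ⟨h.isClique_of_P3addP1_free hF, h.symm.isClique_of_P3addP1_free hF⟩)

theorem determinedBy_of_small_cliques [Finite V] (h : FullPair G S A B)
    (hF : ¬ P2add2P1.graph.IsIndContained G ∨ ¬ P3addP1.graph.IsIndContained G) {K : ℕ}
    (hK : 1 ≤ K) (hA : G.IsClique A → A.ncard ≤ K) :
    ∃ X : Finset V, X.card ≤ K ∧ DeterminedBy G X S := by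
  rcases h.isClique_or_ncard_le hF with h1 | h1 | ⟨h1, -⟩
  · exact h.determinedBy_of_card_le (h1.trans hK)
  · exact h.symm.determinedBy_of_card_le (h1.trans hK)
  · exact h.determinedBy_of_card_le (hA h1)

theorem not_triangle_of_K3addP1_free (h : FullPair G S A B)
    (hF : ¬ K3addP1.graph.IsIndContained G) {x y z : V} (hx : x ∈ A) (hy : y ∈ A) (hz : z ∈ A)
    (hxy : G.Adj x y) (hxz : G.Adj x z) (hyz : G.Adj y z) : False := by
  obtain ⟨b, hb⟩ := h.nonemptyB
  exact hF (K3addP1_isIndContained hxy hxz hyz (h.not_adj hx hb) (h.not_adj hy hb)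
    (h.not_adj hz hb))

/-- In a paw-free graph, two adjacent neighbours of `s ∈ S` do not lie in the same full component. -/
theorem not_adj_of_paw_free (h : FullPair G S A B) (hF : ¬ paw.graph.IsIndContained G) {s x y : V}
    (hs : s ∈ S) (hx : x ∈ A) (hy : y ∈ A) (hsx : G.Adj s x) (hsy : G.Adj s y) : ¬ G.Adj x y := by
  intro hxy
  obtain ⟨b, hb, hsb⟩ := h.fullB s hs
  exact hF (paw_isIndContained hxy hsx.symm hsy.symm hsb (h.not_adj hx hb) (h.not_adj hy hb))

/-- In a paw-free graph, a vertex outside a triangle that sees one corner also sees another (`two`).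
Lying in a triangle therefore spreads through `A` and reaches a neighbour of some `s ∈ S`; then `s`
has two adjacent neighbours in `A`, which is impossible. -/
theorem not_triangle_of_paw_free (h : FullPair G S A B) (hF : ¬ paw.graph.IsIndContained G)
    (hS : S.Nonempty) {x y z : V} (hx : x ∈ A) (hy : y ∈ A) (hz : z ∈ A)
    (hxy : G.Adj x y) (hxz : G.Adj x z) (hyz : G.Adj y z) : False := by
  have two : ∀ u v w t, G.Adj u v → G.Adj u w → G.Adj v w → G.Adj t w → t ≠ u → t ≠ v →
      G.Adj t u ∨ G.Adj t v := by
    intro u v w t huv huw hvw htw _ _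
    by_contra! hcon
    exact hF (paw_isIndContained huv huw hvw htw.symm (fun h => hcon.1 h.symm)
      (fun h => hcon.2 h.symm))
  have tri : ∀ w ∈ A, ∃ u ∈ A, ∃ v ∈ A, G.Adj u v ∧ G.Adj u w ∧ G.Adj v w := by
    refine h.connA (fun w => ∃ u ∈ A, ∃ v ∈ A, G.Adj u v ∧ G.Adj u w ∧ G.Adj v w)
      ⟨z, hz, x, hx, y, hy, hxy, hxz, hyz⟩ ?_
    rintro w hw ⟨u, hu, v, hv, huv, huw, hvw⟩ t ht hwt
    by_cases htu : t = u
    · subst htu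
      exact ⟨v, hv, w, hw, hvw, huv.symm, hwt⟩
    by_cases htv : t = v
    · subst htv
      exact ⟨u, hu, w, hw, huw, huv, hwt⟩
    rcases two u v w t huv huw hvw hwt.symm htu htv with h1 | h1
    · exact ⟨u, hu, w, hw, huw, h1.symm, hwt⟩
    · exact ⟨v, hv, w, hw, hvw, h1.symm, hwt⟩
  obtain ⟨s, hs⟩ := hS
  obtain ⟨w, hw, hsw⟩ := h.fullA s hs
  obtain ⟨u, hu, v, hv, huv, huw, hvw⟩ := tri w hw
  rcases two u v w s huv huw hvw hsw (h.ne_left hs hu) (h.ne_left hs hv) with h1 | h1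
  · exact h.not_adj_of_paw_free hF hs hu hw h1 hsw huw
  · exact h.not_adj_of_paw_free hF hs hv hw h1 hsw hvw

/-- Full components of `{K₃ + P₁}`-free or paw-free graphs are triangle-free, provided `S ≠ ∅`. -/
theorem not_triangle (h : FullPair G S A B)
    (hF : ¬ K3addP1.graph.IsIndContained G ∨ ¬ paw.graph.IsIndContained G)
    (hS : S.Nonempty) {x y z : V} (hx : x ∈ A) (hy : y ∈ A) (hz : z ∈ A)
    (hxy : G.Adj x y) (hxz : G.Adj x z) (hyz : G.Adj y z) : False := by
  rcases hF with hF | hF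
  · exact h.not_triangle_of_K3addP1_free hF hx hy hz hxy hxz hyz
  · exact h.not_triangle_of_paw_free hF hS hx hy hz hxy hxz hyz

end FullPair

theorem determinedBy_empty (K : ℕ) :
    ∃ X : Finset V, X.card ≤ K ∧ DeterminedBy G X (∅ : Set V) :=
  ⟨∅, by simp, fun _ _ _ hv => hv.elim⟩

theorem FullPair.determinedBy_of_clique_of_triangle_free [Finite V] (h : FullPair G S A B)
    (hF : ¬ P2add2P1.graph.IsIndContained G ∨ ¬ P3addP1.graph.IsIndContained G)
    (hF' : ¬ K3addP1.graph.IsIndContained G ∨ ¬ paw.graph.IsIndContained G) :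
    ∃ X : Finset V, X.card ≤ 2 ∧ DeterminedBy G X S := by
  -- For `S = ∅` the full component may contain triangles in the paw-free case, so this case is
  -- separated.
  rcases S.eq_empty_or_nonempty with rfl | hS
  · exact determinedBy_empty 2
  refine h.determinedBy_of_small_cliques hF (by norm_num) fun hA => ?_
  by_contra! hlt
  rw [Set.two_lt_ncard_iff] at hlt
  obtain ⟨x, y, z, hx, hy, hz, hxy, hxz, hyz⟩ := hlt
  exact h.not_triangle hF' hS hx hy hz (hA hx hy hxy) (hA hx hz hxz) (hA hy hz hyz)

/-- If the traces on `A` of the neighbourhoods of the vertices of `T` are nonempty, and any two of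
them are nested or else disjoint and covering all but at most one vertex of `A`, then at most two
vertices of `A` dominate `T`. -/
theorem exists_two_dominating [Finite V] {T : Set V} (hA : 4 ≤ A.ncard)
    (hT : ∀ t ∈ T, ∃ a ∈ A, G.Adj t a)
    (h : ∀ s ∈ T, ∀ t ∈ T, (∀ a ∈ A, G.Adj s a → G.Adj t a) ∨ (∀ a ∈ A, G.Adj t a → G.Adj s a) ∨
      ((∀ a ∈ A, G.Adj s a → ¬ G.Adj t a) ∧ ∀ a ∈ A, ∀ a' ∈ A, ¬ G.Adj s a → ¬ G.Adj t a →
        ¬ G.Adj s a' → ¬ G.Adj t a' → a = a')) :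
    ∃ A₀ : Finset V, A₀.card ≤ 2 ∧ (∀ a ∈ A₀, a ∈ A) ∧ ∀ t ∈ T, ∃ a ∈ A₀, G.Adj t a := by
  classical
  let f : V → ℕ := fun t => {a ∈ A | G.Adj t a}.ncard
  have lt_of : ∀ s t, (∀ a ∈ A, G.Adj s a → G.Adj t a) → (∃ a ∈ A, G.Adj t a ∧ ¬ G.Adj s a) →
      f s < f t := by
    rintro s t hst ⟨a, ha, hta, hsa⟩
    refine Set.ncard_lt_ncard ⟨fun x hx => ⟨hx.1, hst x hx.1 hx.2⟩, fun hsub => ?_⟩ (Set.toFinite _)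
    exact hsa (hsub ⟨ha, hta⟩).2
  rcases T.eq_empty_or_nonempty with rfl | hTne
  · exact ⟨∅, by simp, by simp, by simp⟩
  -- `s` has the smallest trace, and `t` below the smallest among those missing `a`. If `u` misses
  -- both `a` and `a'`, no two of `s`, `t`, `u` have nested traces: one inclusion fails at `a` or
  -- `a'`, the other contradicts minimality.
  obtain ⟨s, hs, hsmin⟩ := Set.exists_min_image T f (Set.toFinite _) hTne
  obtain ⟨a, ha, hsa⟩ := hT s hs
  rcases {t ∈ T | ¬ G.Adj t a}.eq_empty_or_nonempty with hE | hE
  · refine ⟨{a}, by simp, by simpa, fun t ht => ⟨a, by simp, ?_⟩⟩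
    by_contra hta
    exact hE.subset ⟨ht, hta⟩
  obtain ⟨t, ⟨ht, hta⟩, htmin⟩ := Set.exists_min_image _ f (Set.toFinite _) hE
  obtain ⟨a', ha', hta'⟩ := hT t ht
  refine ⟨{a, a'}, Finset.card_le_two, by simp [ha, ha'], fun u hu => ?_⟩
  by_contra! hcon
  have hua := hcon a (by simp)
  have hua' := hcon a' (by simp)
  have hst := (h s hs t ht).resolve_left fun h1 => hta (h1 a ha hsa)
  replace hst := hst.resolve_left fun h1 => (hsmin t ht).not_gt (lt_of t s h1 ⟨a, ha, hsa, hta⟩)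
  have hsu := (h s hs u hu).resolve_left fun h1 => hua (h1 a ha hsa)
  replace hsu := hsu.resolve_left fun h1 => (hsmin u hu).not_gt (lt_of u s h1 ⟨a, ha, hsa, hua⟩)
  have htu := (h t ht u hu).resolve_left fun h1 => hua' (h1 a' ha' hta')
  replace htu := htu.resolve_left fun h1 =>
    (htmin u ⟨hu, hua⟩).not_gt (lt_of u t h1 ⟨a', ha', hta', hua'⟩)
  obtain ⟨v, hv, hvA⟩ := exists_injective_of_le_ncard hA
  -- Each vertex of `A` is seen by `s`, by `t`, or by neither, so two of four vertices share a
  -- class. As the three traces are pairwise disjoint, those two vertices are missed by a common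
  -- pair among `s`, `t`, `u`, and hence coincide.
  obtain ⟨i, j, hij, hc⟩ := Fintype.exists_ne_map_eq_of_card_lt
    (fun i => if G.Adj s (v i) then (0 : Fin 3) else if G.Adj t (v i) then 1 else 2) (by simp)
  refine hij (hv ?_)
  by_cases h1 : G.Adj s (v i) <;> by_cases h2 : G.Adj s (v j) <;>
    by_cases h3 : G.Adj t (v i) <;> by_cases h4 : G.Adj t (v j) <;> simp [h1, h2, h3, h4] at hc
  · exact absurd h3 (hst.1 _ (hvA i) h1)
  · exact absurd h3 (hst.1 _ (hvA i) h1)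
  · exact absurd h4 (hst.1 _ (hvA j) h2)
  · exact htu.2 _ (hvA i) _ (hvA j) h3 (hsu.1 _ (hvA i) h1) h4 (hsu.1 _ (hvA j) h2)
  · exact hsu.2 _ (hvA i) _ (hvA j) h1 (htu.1 _ (hvA i) h3) h2 (htu.1 _ (hvA j) h4)
  · exact hst.2 _ (hvA i) _ (hvA j) h1 h3 h2 h4

/-- Split `S` by completeness to `B`. Two complete vertices with non-nested traces are non-adjacent
and have no common neighbour in `A`, by `C₄`-freeness, and missing two vertices of `A` in common
gives a forbidden `P₂ + 2P₁` or `P₃ + P₁`; so two vertices dominate this part. A vertex of `S` that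
misses some `b ∈ B` is dominated by any two vertices of `A`. This accounts for `4 = 2 + 2`. -/
theorem FullPair.exists_dominating_of_C4_free [Finite V] (h : FullPair G S A B)
    (hF : ¬ P2add2P1.graph.IsIndContained G ∨ ¬ P3addP1.graph.IsIndContained G)
    (hC : ¬ C4.graph.IsIndContained G) (hcl : G.IsClique A) (hA : 4 ≤ A.ncard) :
    ∃ A₀ : Finset V, A₀.card ≤ 4 ∧ (∀ a ∈ A₀, a ∈ A) ∧ ∀ s ∈ S, ∃ a ∈ A₀, G.Adj s a := by
  classical
  obtain ⟨A₀, hc, hA₀, hdom⟩ := exists_two_dominating (G := G)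
    (T := {s ∈ S | ∀ b ∈ B, G.Adj s b}) hA (fun t ht => h.fullA t ht.1) (by
    rintro s ⟨hs, hsB⟩ t ⟨ht, htB⟩
    by_contra! hcon
    obtain ⟨⟨a, ha, hsa, hta⟩, ⟨a', ha', hta', hsa'⟩, hcon⟩ := hcon
    obtain ⟨b, hb⟩ := h.nonemptyB
    have haa' : a ≠ a' := by rintro rfl; exact hsa' hsa
    have hst : s ≠ t := by rintro rfl; exact hsa' hta'
    have hadj : G.Adj a a' := hcl ha ha' haa'
    have nst : ¬ G.Adj s t := fun hadj' => hC (C4_isIndContained hsa hadj hta'.symm hadj'.symm hsa'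
      (fun h => hta h.symm) (h.ne_left hs ha') (h.ne_left ht ha).symm)
    obtain ⟨x, hx, y, hy, h1, h2, h3, h4, h5⟩ := hcon fun c hc hsc htc =>
      hC (C4_isIndContained hsc htc.symm (htB b hb) (hsB b hb).symm nst (h.not_adj hc hb) hst
        (h.ne hc hb))
    rcases hF with hF | hF
    · exact hF (P2add2P1_isIndContained (hcl hx hy h5) (fun h => h1 h.symm) (fun h => h2 h.symm)
        (fun h => h3 h.symm) (fun h => h4 h.symm) nst hst)
    · exact hF (P3addP1_isIndContained (hsB b hb) (htB b hb).symm nst h1 (h.not_adj' hx hb) h2 hst))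
  obtain ⟨x, y, hx, hy, hxy⟩ := (Set.one_lt_ncard_iff (Set.toFinite A)).1 (show 1 < A.ncard by omega)
  refine ⟨A₀ ∪ {x, y}, (Finset.card_union_le _ _).trans ?_, ?_, fun s hs => ?_⟩
  · have : ({x, y} : Finset V).card ≤ 2 := Finset.card_le_two
    omega
  · intro a ha
    simp only [Finset.mem_union, Finset.mem_insert, Finset.mem_singleton] at ha
    rcases ha with ha | rfl | rfl
    exacts [hA₀ a ha, hx, hy]
  · by_cases hsB : ∀ b ∈ B, G.Adj s b
    · obtain ⟨a, ha, hsa⟩ := hdom s ⟨hs, hsB⟩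
      exact ⟨a, by simp [ha], hsa⟩
    push Not at hsB
    obtain ⟨b, hb, hsb⟩ := hsB
    by_contra! hcon
    have hsx := hcon x (by simp)
    have hsy := hcon y (by simp)
    rcases hF with hF | hF
    · exact hF (P2add2P1_isIndContained (hcl hx hy hxy) (fun h => hsx h.symm) (h.not_adj hx hb)
        (fun h => hsy h.symm) (h.not_adj hy hb) hsb (h.ne_right hs hb))
    · obtain ⟨a, ha, hsa⟩ := h.fullA s hs
      have hax : a ≠ x := by rintro rfl; exact hsx hsa
      exact hF (P3addP1_isIndContained hsa (hcl ha hx hax) hsx hsb (h.not_adj ha hb)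
        (h.not_adj hx hb) (h.ne_left hs hx))

theorem FullPair.determinedBy_of_C4_free [Finite V] (h : FullPair G S A B)
    (hF : ¬ P2add2P1.graph.IsIndContained G ∨ ¬ P3addP1.graph.IsIndContained G)
    (hC : ¬ C4.graph.IsIndContained G) :
    ∃ X : Finset V, X.card ≤ 8 ∧ DeterminedBy G X S := by
  by_cases hA : A.ncard ≤ 3
  · exact h.determinedBy_of_card_le (by omega)
  by_cases hB : B.ncard ≤ 3
  · exact h.symm.determinedBy_of_card_le (by omega)
  rcases h.isClique_or_ncard_le hF with h1 | h1 | ⟨h1, h2⟩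
  · omega
  · omega
  obtain ⟨A₀, cA, hA₀, dA⟩ := h.exists_dominating_of_C4_free hF hC h1 (by omega)
  obtain ⟨B₀, cB, hB₀, dB⟩ := h.symm.exists_dominating_of_C4_free hF hC h2 (by omega)
  exact h.determinedBy_of_dominating hA₀ hB₀ dA dB cA cB

end Cliques

/-! ### Bounds from Ramsey arguments, vertex degrees and the diamond. -/

section Components

variable {V : Type*} {G : SimpleGraph V} {S A B : Set V}

/-- The Ramsey bound `R(3,3) ≤ 6`. -/
theorem exists_triangle_or_independent [Finite V] (G : SimpleGraph V) (hA : 6 ≤ A.ncard) :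
    (∃ x ∈ A, ∃ y ∈ A, ∃ z ∈ A, G.Adj x y ∧ G.Adj x z ∧ G.Adj y z) ∨
      ∃ x ∈ A, ∃ y ∈ A, ∃ z ∈ A, x ≠ y ∧ x ≠ z ∧ y ≠ z ∧
        ¬ G.Adj x y ∧ ¬ G.Adj x z ∧ ¬ G.Adj y z := by
  by_contra! hcon
  obtain ⟨ht, hi⟩ := hcon
  obtain ⟨x, hx⟩ : A.Nonempty := Set.nonempty_of_ncard_ne_zero (by omega)
  have hsub : A ⊆ insert x ({y ∈ A | G.Adj x y} ∪ {y ∈ A | x ≠ y ∧ ¬ G.Adj x y}) := by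
    intro y hy
    by_cases h1 : x = y
    · exact Or.inl h1.symm
    · by_cases h2 : G.Adj x y
      · exact Or.inr (Or.inl ⟨hy, h2⟩)
      · exact Or.inr (Or.inr ⟨hy, h1, h2⟩)
  have hcard := (Set.ncard_le_ncard hsub (Set.toFinite _)).trans (Set.ncard_insert_le _ _)
  have hcard' := Set.ncard_union_le {y ∈ A | G.Adj x y} {y ∈ A | x ≠ y ∧ ¬ G.Adj x y}
  rcases (by omega : 2 < {y ∈ A | G.Adj x y}.ncard ∨ 2 < {y ∈ A | x ≠ y ∧ ¬ G.Adj x y}.ncard)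
    with h | h
  · rw [Set.two_lt_ncard_iff] at h
    obtain ⟨a, b, c, ⟨ha, hxa⟩, ⟨hb, hxb⟩, ⟨hc, hxc⟩, hab, hac, hbc⟩ := h
    exact ht b hb c hc x hx (hi a ha b hb c hc hab hac hbc (ht x hx a ha b hb hxa hxb)
      (ht x hx a ha c hc hxa hxc)) hxb.symm hxc.symm
  · rw [Set.two_lt_ncard_iff] at h
    obtain ⟨a, b, c, ⟨ha, hxa, hxa'⟩, ⟨hb, hxb, hxb'⟩, ⟨hc, hxc, hxc'⟩, hab, hac, hbc⟩ := h
    exact ht a ha b hb c hc (hi x hx a ha b hb hxa hxb hab hxa' hxb')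
      (hi x hx a ha c hc hxa hxc hac hxa' hxc') (hi x hx b hb c hc hxb hxc hbc hxb' hxc')

namespace FullPair

theorem not_independent_of_fourP1_free (h : FullPair G S A B)
    (hF : ¬ fourP1.graph.IsIndContained G) {x y z : V} (hx : x ∈ A) (hy : y ∈ A) (hz : z ∈ A)
    (hxy : ¬ G.Adj x y) (hxz : ¬ G.Adj x z) (hyz : ¬ G.Adj y z) (nxy : x ≠ y) (nxz : x ≠ z)
    (nyz : y ≠ z) : False := by
  obtain ⟨b, hb⟩ := h.nonemptyB
  exact hF (fourP1_isIndContained hxy hxz (h.not_adj hx hb) hyz (h.not_adj hy hb) (h.not_adj hz hb)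
    nxy nxz (h.ne hx hb) nyz (h.ne hy hb) (h.ne hz hb))

/-- An independent triple of `A` together with a vertex of `B` is `4P₁`, and triangles in `A` are
excluded, so `R(3,3) ≤ 6` bounds `A`. -/
theorem determinedBy_of_fourP1_free_of_triangle_free [Finite V] (h : FullPair G S A B)
    (hF : ¬ fourP1.graph.IsIndContained G)
    (hF' : ¬ K3addP1.graph.IsIndContained G ∨ ¬ paw.graph.IsIndContained G) :
    ∃ X : Finset V, X.card ≤ 5 ∧ DeterminedBy G X S := by
  rcases S.eq_empty_or_nonempty with rfl | hS
  · exact determinedBy_empty 5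
  refine h.determinedBy_of_card_le ?_
  by_contra! hlt
  rcases exists_triangle_or_independent G hlt with ⟨x, hx, y, hy, z, hz, hxy, hxz, hyz⟩ |
    ⟨x, hx, y, hy, z, hz, nxy, nxz, nyz, hxy, hxz, hyz⟩
  · exact h.not_triangle hF' hS hx hy hz hxy hxz hyz
  · exact h.not_independent_of_fourP1_free hF hx hy hz hxy hxz hyz nxy nxz nyz

/-- With ten vertices in `A`, the non-neighbours of `x` in `A` form a clique of size at most 3,
leaving at least six neighbours. Among these a triangle gives `K₄` with `x`, and an independent
triple gives `4P₁` with a vertex of `B`. -/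
theorem determinedBy_of_fourP1_K4_free [Finite V] (h : FullPair G S A B)
    (hF : ¬ fourP1.graph.IsIndContained G) (hF' : ¬ K4.graph.IsIndContained G) :
    ∃ X : Finset V, X.card ≤ 9 ∧ DeterminedBy G X S := by
  refine h.determinedBy_of_card_le ?_
  by_contra! hlt
  obtain ⟨x, hx⟩ := h.nonemptyA
  have hsub : A ⊆ insert x ({y ∈ A | G.Adj x y} ∪ {y ∈ A | x ≠ y ∧ ¬ G.Adj x y}) := by
    intro y hy
    by_cases h1 : x = y
    · exact Or.inl h1.symm
    · by_cases h2 : G.Adj x y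
      · exact Or.inr (Or.inl ⟨hy, h2⟩)
      · exact Or.inr (Or.inr ⟨hy, h1, h2⟩)
  have hcard := (Set.ncard_le_ncard hsub (Set.toFinite _)).trans (Set.ncard_insert_le _ _)
  have hcard' := Set.ncard_union_le {y ∈ A | G.Adj x y} {y ∈ A | x ≠ y ∧ ¬ G.Adj x y}
  have hclique : G.IsClique {y ∈ A | x ≠ y ∧ ¬ G.Adj x y} := by
    rintro y ⟨hy, nxy, hxy⟩ z ⟨hz, nxz, hxz⟩ hyz
    by_contra hadj
    exact h.not_independent_of_fourP1_free hF hx hy hz hxy hxz hadj nxy nxz hyz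
  have hM := ncard_clique_le_of_K4_free hF' hclique
  rcases exists_triangle_or_independent G (by omega : 6 ≤ {y ∈ A | G.Adj x y}.ncard) with
    ⟨u, hu, v, hv, w, hw, huv, huw, hvw⟩ | ⟨u, hu, v, hv, w, hw, nuv, nuw, nvw, huv, huw, hvw⟩
  · exact hF' (K4_isIndContained hu.2 hv.2 hw.2 huv huw hvw)
  · exact h.not_independent_of_fourP1_free hF hu.1 hv.1 hw.1 huv huw hvw nuv nuw nvw

theorem connected_induce (h : FullPair G S A B) : (G.induce A).Connected := by
  have : Nonempty A := h.nonemptyA.to_subtype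
  refine ⟨fun x y => ?_⟩
  obtain ⟨hy, hr⟩ := h.connA (fun v => ∃ hv : v ∈ A, (G.induce A).Reachable x ⟨v, hv⟩)
    ⟨x, x.2, x.2, .refl _⟩ (by
      rintro u hu ⟨_, hr⟩ v hv huv
      exact ⟨hv, hr.trans (Adj.reachable (by simpa using huv))⟩) y y.2
  exact hr

/-- If every vertex of `A` has degree at most two, then `S` has at most two vertices. -/
theorem ncard_separator_le_two [Finite V] (h : FullPair G S A B)
    (hdeg : ∀ a ∈ A, ∀ x y z, G.Adj a x → G.Adj a y → G.Adj a z → x ≠ y → x ≠ z → y ≠ z → False) :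
    S.ncard ≤ 2 := by
  classical
  have := Fintype.ofFinite V
  let H := G.induce A
  let g : A → Finset V := fun a => {s ∈ S.toFinset | G.Adj s a}
  -- Connectedness gives at least `|A| - 1` edges inside `A`. Summing degrees over `A` then yields
  -- `2(|A| - 1) + |S| ≤ 2|A|`.
  have h1 : Fintype.card A ≤ H.edgeFinset.card + 1 := by
    have := h.connected_induce.card_vert_le_card_edgeSet_add_one
    rw [Nat.card_eq_fintype_card, Nat.card_eq_fintype_card, ← edgeFinset_card] at this
    convert this
  have h2 : ∑ a, H.degree a = 2 * H.edgeFinset.card := sum_degrees_eq_twice_card_edges H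
  have h3 : ∀ a : A, H.degree a + (g a).card ≤ 2 := by
    intro a
    have hle : (G.neighborFinset a).card ≤ 2 := by
      by_contra! hlt
      obtain ⟨x, hx, y, hy, z, hz, nxy, nxz, nyz⟩ := Finset.two_lt_card.1 hlt
      simp only [mem_neighborFinset] at hx hy hz
      exact hdeg a a.2 x y z hx hy hz nxy nxz nyz
    have hdisj : Disjoint ((H.neighborFinset a).map (Function.Embedding.subtype _)) (g a) := by
      rw [Finset.disjoint_left]
      intro v hv hvg
      simp only [Finset.mem_map, Function.Embedding.subtype_apply, g, Finset.mem_filter,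
        Set.mem_toFinset] at hv hvg
      obtain ⟨w, -, rfl⟩ := hv
      exact h.notMemA _ hvg.1 w.2
    rw [← card_neighborFinset_eq_degree, ← Finset.card_map (Function.Embedding.subtype _),
      ← Finset.card_union_of_disjoint hdisj]
    refine (Finset.card_le_card ?_).trans hle
    intro v hv
    simp only [Finset.mem_union, Finset.mem_map, Function.Embedding.subtype_apply, g,
      Finset.mem_filter, mem_neighborFinset] at hv ⊢
    rcases hv with ⟨w, hw, rfl⟩ | ⟨-, hv⟩
    · simpa [H] using hw
    · exact hv.symm
  have h4 : S.toFinset.card ≤ ∑ a, (g a).card := by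
    refine (Finset.card_le_card ?_).trans Finset.card_biUnion_le
    intro s hs
    obtain ⟨a, ha, hsa⟩ := h.fullA s (by simpa using hs)
    simp only [Finset.mem_biUnion, Finset.mem_univ, true_and]
    exact ⟨⟨a, ha⟩, by simp [g, hsa, by simpa using hs]⟩
  have h5 : ∑ a, (H.degree a + (g a).card) ≤ ∑ _a : A, 2 := Finset.sum_le_sum fun a _ => h3 a
  rw [Finset.sum_add_distrib, h2] at h5
  simp only [Finset.sum_const, Finset.card_univ, smul_eq_mul] at h5
  rw [Set.ncard_eq_toFinset_card']
  omega

theorem ncard_separator_le_two_of_claw_free [Finite V] (h : FullPair G S A B)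
    (hF : ¬ claw.graph.IsIndContained G)
    (htri : ∀ a ∈ A, ∀ x y, G.Adj a x → G.Adj a y → ¬ G.Adj x y) : S.ncard ≤ 2 :=
  h.ncard_separator_le_two fun a ha x y z hx hy hz nxy nxz nyz =>
    hF (claw_isIndContained hx hy hz (htri a ha x y hx hy) (htri a ha x z hx hz)
      (htri a ha y z hy hz) nxy nxz nyz)

/-- Once `A` has two vertices, no triangle of `G` meets `A`; claw-freeness then bounds the degrees
on `A` by two, and `S` has at most two vertices. -/
theorem determinedBy_of_claw_paw_free [Finite V] (h : FullPair G S A B)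
    (hF : ¬ claw.graph.IsIndContained G) (hF' : ¬ paw.graph.IsIndContained G) :
    ∃ X : Finset V, X.card ≤ 2 ∧ DeterminedBy G X S := by
  rcases S.eq_empty_or_nonempty with rfl | hS
  · exact determinedBy_empty 2
  by_cases hA : A.ncard ≤ 1
  · exact h.determinedBy_of_card_le (by omega)
  push Not at hA
  refine determinedBy_of_ncard_separator_le (h.ncard_separator_le_two_of_claw_free hF ?_)
  intro a ha x y hax hay hxy
  have key : ∀ s ∈ S, ∀ c ∈ A, G.Adj a s → G.Adj a c → ¬ G.Adj s c := fun s hs c hc has hac hsc =>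
    h.not_adj_of_paw_free hF' hs ha hc has.symm hsc hac
  rcases h.nbrA a ha x hax with hx | hx <;> rcases h.nbrA a ha y hay with hy | hy
  · exact h.not_triangle_of_paw_free hF' hS ha hx hy hax hay hxy
  · exact key y hy x hx hay hax hxy.symm
  · exact key x hx y hy hax hay hxy
  -- Both other corners lie in `S`: a neighbour `w` of `a` in `A` sees neither of them by `key`, and
  -- hangs off the triangle as a paw.
  · rw [Set.one_lt_ncard_iff] at hA
    obtain ⟨u, v, hu, hv, huv⟩ := hA
    obtain ⟨w, hw, haw⟩ : ∃ w ∈ A, G.Adj a w := by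
      by_cases hau : a = u
      · exact h.connA.exists_adj ha hv (hau ▸ huv)
      · exact h.connA.exists_adj ha hu hau
    exact hF' (paw_isIndContained hxy hax.symm hay.symm haw (key x hx w hw hax haw)
      (key y hy w hw hay haw))

/-- Vertices of `A` have at most two neighbours in `A`, and by claw-freeness the neighbours in `A`
of a vertex of `S` are pairwise adjacent. If `A` has more than `6 = 3 + 3` vertices, some `d ∈ A`
avoids the closed neighbourhoods of the corners in `A` of a triangle that has at most two corners in
`A` and the others in `S`. Such a `d` misses the whole triangle, giving `K₃ + P₁`. So no triangle
meets `A`, and `S` has at most two vertices. -/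
theorem determinedBy_of_claw_K3addP1_free [Finite V] (h : FullPair G S A B)
    (hF : ¬ claw.graph.IsIndContained G) (hF' : ¬ K3addP1.graph.IsIndContained G) :
    ∃ X : Finset V, X.card ≤ 6 ∧ DeterminedBy G X S := by
  classical
  by_cases hA : A.ncard ≤ 6
  · exact h.determinedBy_of_card_le (by omega)
  push Not at hA
  have hnbr : ∀ a ∈ A, ∃ X : Finset V, X.card ≤ 3 ∧ a ∈ X ∧ ∀ c ∈ A, G.Adj a c → c ∈ X := by
    intro a ha
    have hfin := Set.toFinite {c ∈ A | G.Adj a c}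
    have h2 : {c ∈ A | G.Adj a c}.ncard ≤ 2 := by
      by_contra! hlt
      obtain ⟨x, y, z, ⟨hx, hax⟩, ⟨hy, hay⟩, ⟨hz, haz⟩, nxy, nxz, nyz⟩ :=
        (Set.two_lt_ncard_iff hfin).1 hlt
      exact hF (claw_isIndContained hax hay haz
        (fun hadj => h.not_triangle_of_K3addP1_free hF' ha hx hy hax hay hadj)
        (fun hadj => h.not_triangle_of_K3addP1_free hF' ha hx hz hax haz hadj)
        (fun hadj => h.not_triangle_of_K3addP1_free hF' ha hy hz hay haz hadj) nxy nxz nyz)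
    rw [Set.ncard_eq_toFinset_card _ hfin] at h2
    refine ⟨insert a hfin.toFinset, (Finset.card_insert_le _ _).trans (by omega), by simp, ?_⟩
    intro c hc hac
    simp [hc, hac]
  have hcl : ∀ s ∈ S, ∀ a ∈ A, ∀ c ∈ A, a ≠ c → G.Adj s a → ¬ G.Adj a c → ¬ G.Adj s c := by
    intro s hs a ha c hc nac hsa hac hsc
    obtain ⟨b, hb, hsb⟩ := h.fullB s hs
    exact hF (claw_isIndContained hsa hsc hsb hac (h.not_adj ha hb) (h.not_adj hc hb) nac
      (h.ne ha hb) (h.ne hc hb))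
  have mixed : ∀ a ∈ A, ∀ c ∈ A, ∀ s ∈ S, G.Adj a c → G.Adj a s → G.Adj c s → False := by
    intro a ha c hc s hs hac has hcs
    obtain ⟨X, hX, haX, hXn⟩ := hnbr a ha
    obtain ⟨Y, hY, hcY, hYn⟩ := hnbr c hc
    obtain ⟨d, hd, hdXY⟩ := exists_mem_notMem_of_card_lt (A := A) (X := X ∪ Y)
      ((Finset.card_union_le _ _).trans_lt (by omega))
    simp only [Finset.mem_union, not_or] at hdXY
    have had : ¬ G.Adj a d := fun hadj => hdXY.1 (hXn d hd hadj)
    have hcd : ¬ G.Adj c d := fun hadj => hdXY.2 (hYn d hd hadj)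
    exact hF' (K3addP1_isIndContained hac has hcs had hcd
      (hcl s hs a ha d hd (fun e => hdXY.1 (e ▸ haX)) has.symm had))
  obtain ⟨X, hX, hdet⟩ := determinedBy_of_ncard_separator_le (G := G)
    (h.ncard_separator_le_two_of_claw_free hF (by
      intro a ha x y hax hay hxy
      rcases h.nbrA a ha x hax with hx | hx <;> rcases h.nbrA a ha y hay with hy | hy
      · exact h.not_triangle_of_K3addP1_free hF' ha hx hy hax hay hxy
      · exact mixed a ha x hx y hy hax hay hxy
      · exact mixed a ha y hy x hx hay hax hxy.symm
      · obtain ⟨X, hX, haX, hXn⟩ := hnbr a ha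
        obtain ⟨d, hd, hdX⟩ := exists_mem_notMem_of_card_lt (A := A) (X := X) (by omega)
        have had : ¬ G.Adj a d := fun hadj => hdX (hXn d hd hadj)
        have nad : a ≠ d := fun e => hdX (e ▸ haX)
        exact hF' (K3addP1_isIndContained hax hay hxy had (hcl x hx a ha d hd nad hax.symm had)
          (hcl y hy a ha d hd nad hay.symm had))))
  exact ⟨X, hX.trans (by norm_num), hdet⟩

theorem isClique_or_isClique_of_fourP1_free (h : FullPair G S A B)
    (hF : ¬ fourP1.graph.IsIndContained G) : G.IsClique A ∨ G.IsClique B := by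
  by_contra! hcon
  simp only [isClique_iff, Set.Pairwise] at hcon
  push Not at hcon
  obtain ⟨⟨a, ha, a', ha', naa', haa'⟩, b, hb, b', hb', nbb', hbb'⟩ := hcon
  exact hF (fourP1_isIndContained haa' (h.not_adj ha hb) (h.not_adj ha hb') (h.not_adj ha' hb)
    (h.not_adj ha' hb') hbb' naa' (h.ne ha hb) (h.ne ha hb') (h.ne ha' hb) (h.ne ha' hb') nbb')

/-- By diamond-freeness, a vertex of `S` with two neighbours in the clique `A` is complete to `A`.
Let `Q` be the set of complete ones and `T` the set of attachment points in `A` of the others. Both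
have at most two elements, and `Q`, `T` and two vertices of `A` together determine `S`. -/
theorem determinedBy_of_fourP1_C4_diamond_free_of_isClique [Finite V] (h : FullPair G S A B)
    (hF : ¬ fourP1.graph.IsIndContained G) (hC : ¬ C4.graph.IsIndContained G)
    (hD : ¬ diamond.graph.IsIndContained G) (hcl : G.IsClique A) :
    ∃ X : Finset V, X.card ≤ 6 ∧ DeterminedBy G X S := by
  classical
  by_cases hA : A.ncard ≤ 3
  · exact h.determinedBy_of_card_le (by omega)
  push Not at hA
  obtain ⟨p, q, hp, hq, npq⟩ := (Set.one_lt_ncard_iff (Set.toFinite A)).1 (by omega)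
  have full : ∀ s ∈ S, ∀ a ∈ A, ∀ c ∈ A, a ≠ c → G.Adj s a → G.Adj s c → ∀ d ∈ A, G.Adj s d := by
    intro s hs a ha c hc nac hsa hsc d hd
    by_contra hsd
    have nda : d ≠ a := by rintro rfl; exact hsd hsa
    have ndc : d ≠ c := by rintro rfl; exact hsd hsc
    exact hD (diamond_isIndContained hsd hsa hsc (hcl hd ha nda) (hcl hd hc ndc) (hcl ha hc nac)
      (h.ne_left hs hd))
  let Q : Set V := {s ∈ S | ∀ a ∈ A, G.Adj s a}
  let T : Set V := {a ∈ A | ∃ s ∈ S, G.Adj s a ∧ s ∉ Q}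
  -- Members of `Q` are pairwise adjacent and have no common neighbour in `B`, by the diamond. Their
  -- neighbours in `B` are then pairwise non-adjacent by `C₄`, so three members would give an
  -- independent triple in `B`.
  have hQ : Q.ncard ≤ 2 := by
    by_contra! hlt
    obtain ⟨s, t, u, ⟨hs, hs'⟩, ⟨ht, ht'⟩, ⟨hu, hu'⟩, nst, nsu, ntu⟩ :=
      (Set.two_lt_ncard_iff (Set.toFinite _)).1 hlt
    have adj : ∀ s t, s ≠ t → (∀ a ∈ A, G.Adj s a) → (∀ a ∈ A, G.Adj t a) → G.Adj s t := by
      intro s t nst hs' ht'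
      by_contra hst
      exact hD (diamond_isIndContained hst (hs' p hp) (hs' q hq) (ht' p hp) (ht' q hq)
        (hcl hp hq npq) nst)
    have priv : ∀ s t, s ≠ t → (∀ a ∈ A, G.Adj s a) → (∀ a ∈ A, G.Adj t a) →
        ∀ b ∈ B, G.Adj s b → ¬ G.Adj t b := by
      intro s t nst hs' ht' b hb hsb htb
      exact hD (diamond_isIndContained (h.not_adj hp hb) (hs' p hp).symm (ht' p hp).symm hsb.symm
        htb.symm (adj s t nst hs' ht') (h.ne hp hb))
    have indep : ∀ s ∈ S, ∀ t ∈ S, s ≠ t → (∀ a ∈ A, G.Adj s a) → (∀ a ∈ A, G.Adj t a) →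
        ∀ b ∈ B, ∀ c ∈ B, G.Adj s b → G.Adj t c → b ≠ c ∧ ¬ G.Adj b c := by
      intro s hs t ht nst hs' ht' b hb c hc hsb htc
      refine ⟨?_, fun hbc => ?_⟩
      · rintro rfl
        exact priv s t nst hs' ht' b hb hsb htc
      · exact hC (C4_isIndContained hsb hbc htc.symm (adj s t nst hs' ht').symm
          (fun h' => priv t s nst.symm ht' hs' c hc htc h')
          (fun h' => priv s t nst hs' ht' b hb hsb h'.symm) (h.ne_right hs hc)
          (h.ne_right ht hb).symm)
    obtain ⟨b, hb, hsb⟩ := h.fullB s hs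
    obtain ⟨c, hc, htc⟩ := h.fullB t ht
    obtain ⟨d, hd, hud⟩ := h.fullB u hu
    have h1 := indep s hs t ht nst hs' ht' b hb c hc hsb htc
    have h2 := indep s hs u hu nsu hs' hu' b hb d hd hsb hud
    have h3 := indep t ht u hu ntu ht' hu' c hc d hd htc hud
    exact h.symm.not_independent_of_fourP1_free hF hb hc hd h1.2 h2.2 h3.2 h1.1 h2.1 h3.1
  -- Vertices attached at three different points are pairwise non-adjacent by `C₄`; a fourth vertex
  -- of `A` completes them to `4P₁`.
  have hT : T.ncard ≤ 2 := by
    by_contra! hlt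
    obtain ⟨a, b, c, ⟨ha, s, hs, hsa, hs'⟩, ⟨hb, t, ht, htb, ht'⟩, ⟨hc, u, hu, huc, hu'⟩, nab, nac,
      nbc⟩ := (Set.two_lt_ncard_iff (Set.toFinite _)).1 hlt
    obtain ⟨d, hd, hdn⟩ := exists_mem_notMem_of_card_lt (A := A) (X := {a, b, c})
      (Finset.card_le_three.trans_lt hA)
    simp only [Finset.mem_insert, Finset.mem_singleton, not_or] at hdn
    have only : ∀ s ∈ S, s ∉ Q → ∀ a ∈ A, ∀ c ∈ A, a ≠ c → G.Adj s a → ¬ G.Adj s c :=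
      fun s hs hs' a ha c hc nac hsa hsc => hs' ⟨hs, full s hs a ha c hc nac hsa hsc⟩
    have indep : ∀ s ∈ S, s ∉ Q → ∀ t ∈ S, t ∉ Q → ∀ a ∈ A, ∀ b ∈ A, a ≠ b → G.Adj s a →
        G.Adj t b → s ≠ t ∧ ¬ G.Adj s t := by
      intro s hs hs' t ht ht' a ha b hb nab hsa htb
      refine ⟨?_, fun hst => ?_⟩
      · rintro rfl
        exact only s hs hs' a ha b hb nab hsa htb
      · exact hC (C4_isIndContained hsa (hcl ha hb nab) htb.symm hst.symm
          (only s hs hs' a ha b hb nab hsa)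
          (fun h' => only t ht ht' b hb a ha nab.symm htb h'.symm) (h.ne_left hs hb)
          (h.ne_left ht ha).symm)
    have h1 := indep s hs hs' t ht ht' a ha b hb nab hsa htb
    have h2 := indep s hs hs' u hu hu' a ha c hc nac hsa huc
    have h3 := indep t ht ht' u hu hu' b hb c hc nbc htb huc
    exact hF (fourP1_isIndContained h1.2 h2.2 (only s hs hs' a ha d hd (Ne.symm hdn.1) hsa) h3.2
      (only t ht ht' b hb d hd (Ne.symm hdn.2.1) htb)
      (only u hu hu' c hc d hd (Ne.symm hdn.2.2) huc) h1.1 h2.1 (h.ne_left hs hd) h3.1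
      (h.ne_left ht hd) (h.ne_left hu hd))
  have fQ := Set.toFinite Q
  have fT := Set.toFinite T
  rw [Set.ncard_eq_toFinset_card _ fQ] at hQ
  rw [Set.ncard_eq_toFinset_card _ fT] at hT
  refine ⟨(fQ.toFinset ∪ fT.toFinset) ∪ {p, q}, ?_, fun v w hvw hv => ?_⟩
  · have h1 := Finset.card_union_le (fQ.toFinset ∪ fT.toFinset) {p, q}
    have h2 := Finset.card_union_le fQ.toFinset fT.toFinset
    have h3 : ({p, q} : Finset V).card ≤ 2 := Finset.card_le_two
    omega
  · simp only [Finset.mem_union, Set.Finite.mem_toFinset, Finset.mem_insert,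
      Finset.mem_singleton] at hvw
    by_cases hvQ : v ∈ Q
    · have := (hvw v (Or.inl (Or.inl hvQ))).2.1 rfl
      rwa [this]
    obtain ⟨a, ha, hva⟩ := h.fullA v hv
    have hwa := (hvw a (Or.inl (Or.inr ⟨ha, v, hv, hva, hvQ⟩))).1.1 hva
    -- This is the role of `p` and `q`: a vertex of `A` with the pattern of `v` would be different
    -- from and adjacent to both, so `v` would see both and belong to `Q`.
    refine (h.nbrA a ha w hwa.symm).resolve_left fun hw => ?_
    have hwp : w ≠ p := fun e => h.ne_left hv hp ((hvw p (Or.inr (Or.inl rfl))).2.2 e)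
    have hwq : w ≠ q := fun e => h.ne_left hv hq ((hvw q (Or.inr (Or.inr rfl))).2.2 e)
    have hvp := (hvw p (Or.inr (Or.inl rfl))).1.2 (hcl hw hp hwp)
    have hvq := (hvw q (Or.inr (Or.inr rfl))).1.2 (hcl hw hq hwq)
    exact hvQ ⟨hv, full v hv p hp q hq npq hvp hvq⟩

theorem determinedBy_of_fourP1_C4_diamond_free [Finite V] (h : FullPair G S A B)
    (hF : ¬ fourP1.graph.IsIndContained G) (hC : ¬ C4.graph.IsIndContained G)
    (hD : ¬ diamond.graph.IsIndContained G) :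
    ∃ X : Finset V, X.card ≤ 6 ∧ DeterminedBy G X S := by
  rcases h.isClique_or_isClique_of_fourP1_free hF with hcl | hcl
  · exact h.determinedBy_of_fourP1_C4_diamond_free_of_isClique hF hC hD hcl
  · exact h.symm.determinedBy_of_fourP1_C4_diamond_free_of_isClique hF hC hD hcl

end FullPair

end Components

/-! ### Tameness of the listed families. -/

theorem IsListed.tame {ℱ : Set FinGraph} (h : IsListed ℱ) : Tame (freeClass ℱ) := by
  rcases h with (rfl | rfl) | ⟨F, hF, rfl⟩ | ⟨F, hF, rfl⟩ | ⟨F, hF, rfl⟩ | ⟨F, hF, rfl⟩ | rfl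
  · exact tame_of_determinedBy 2 fun G hG S A B h => h.determinedBy_of_P4_free (hG _ rfl)
  · exact tame_of_determinedBy 1 fun G hG S A B h => h.determinedBy_of_twoP2_free (hG _ rfl)
  · have h' : ∀ G ∈ freeClass {F, paw}, ¬ F.graph.IsIndContained G.graph ∧
      ¬ paw.graph.IsIndContained G.graph := fun G hG => ⟨hG _ (by simp), hG _ (by simp)⟩
    rcases hF with rfl | rfl | rfl | rfl
    · exact tame_of_determinedBy 5 fun G hG S A B h =>
        h.determinedBy_of_fourP1_free_of_triangle_free (h' G hG).1 (Or.inr (h' G hG).2)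
    · exact tame_of_determinedBy 2 fun G hG S A B h =>
        h.determinedBy_of_clique_of_triangle_free (Or.inl (h' G hG).1) (Or.inr (h' G hG).2)
    · exact tame_of_determinedBy 2 fun G hG S A B h =>
        h.determinedBy_of_clique_of_triangle_free (Or.inr (h' G hG).1) (Or.inr (h' G hG).2)
    · exact tame_of_determinedBy 2 fun G hG S A B h =>
        h.determinedBy_of_claw_paw_free (h' G hG).1 (h' G hG).2
  · have h' : ∀ G ∈ freeClass {F, K3addP1}, ¬ F.graph.IsIndContained G.graph ∧
      ¬ K3addP1.graph.IsIndContained G.graph := fun G hG => ⟨hG _ (by simp), hG _ (by simp)⟩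
    rcases hF with rfl | rfl | rfl | rfl
    · exact tame_of_determinedBy 5 fun G hG S A B h =>
        h.determinedBy_of_fourP1_free_of_triangle_free (h' G hG).1 (Or.inl (h' G hG).2)
    · exact tame_of_determinedBy 2 fun G hG S A B h =>
        h.determinedBy_of_clique_of_triangle_free (Or.inl (h' G hG).1) (Or.inl (h' G hG).2)
    · exact tame_of_determinedBy 2 fun G hG S A B h =>
        h.determinedBy_of_clique_of_triangle_free (Or.inr (h' G hG).1) (Or.inl (h' G hG).2)
    · exact tame_of_determinedBy 6 fun G hG S A B h =>
        h.determinedBy_of_claw_K3addP1_free (h' G hG).1 (h' G hG).2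
  · have h' : ∀ G ∈ freeClass {F, K4}, ¬ F.graph.IsIndContained G.graph ∧
      ¬ K4.graph.IsIndContained G.graph := fun G hG => ⟨hG _ (by simp), hG _ (by simp)⟩
    rcases hF with rfl | rfl | rfl
    · exact tame_of_determinedBy 9 fun G hG S A B h =>
        h.determinedBy_of_fourP1_K4_free (h' G hG).1 (h' G hG).2
    · exact tame_of_determinedBy 3 fun G hG S A B h => h.determinedBy_of_small_cliques
        (Or.inl (h' G hG).1) (by norm_num) (ncard_clique_le_of_K4_free (h' G hG).2)
    · exact tame_of_determinedBy 3 fun G hG S A B h => h.determinedBy_of_small_cliques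
        (Or.inr (h' G hG).1) (by norm_num) (ncard_clique_le_of_K4_free (h' G hG).2)
  · have h' : ∀ G ∈ freeClass {F, C4}, ¬ F.graph.IsIndContained G.graph ∧
      ¬ C4.graph.IsIndContained G.graph := fun G hG => ⟨hG _ (by simp), hG _ (by simp)⟩
    rcases hF with rfl | rfl
    · exact tame_of_determinedBy 8 fun G hG S A B h =>
        h.determinedBy_of_C4_free (Or.inl (h' G hG).1) (h' G hG).2
    · exact tame_of_determinedBy 8 fun G hG S A B h =>
        h.determinedBy_of_C4_free (Or.inr (h' G hG).1) (h' G hG).2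
  · exact tame_of_determinedBy 6 fun G hG S A B h => h.determinedBy_of_fourP1_C4_diamond_free
      (hG _ (by simp)) (hG _ (by simp)) (hG _ (by simp))

theorem Tame.mono {𝒢 ℋ : Set FinGraph} (h : Tame ℋ) (hsub : 𝒢 ⊆ ℋ) : Tame 𝒢 := by
  obtain ⟨p, hp⟩ := h
  exact ⟨p, fun G hG => hp G (hsub hG)⟩

/-! ### Exponentially many minimal separators in doubled graphs. -/

section Doubled

variable {U : Type*}

/-- Two disjoint copies of `H`, with the two copies of each vertex in `M` joined by an edge. -/
def doubled (H : SimpleGraph U) (M : Set U) : SimpleGraph (U × Bool) where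
  Adj x y := (x.2 = y.2 ∧ H.Adj x.1 y.1) ∨ (x.2 ≠ y.2 ∧ x.1 = y.1 ∧ x.1 ∈ M)
  symm := ⟨by
    rintro x y (⟨h1, h2⟩ | ⟨h1, h2, h3⟩)
    · exact Or.inl ⟨h1.symm, h2.symm⟩
    · exact Or.inr ⟨h1.symm, h2.symm, h2 ▸ h3⟩⟩
  loopless := ⟨by
    rintro x (⟨_, h⟩ | ⟨h, _⟩)
    · exact h.ne rfl
    · exact h rfl⟩

theorem doubled_adj {H : SimpleGraph U} {M : Set U} {x y : U × Bool} : (doubled H M).Adj x y ↔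
    (x.2 = y.2 ∧ H.Adj x.1 y.1) ∨ (x.2 ≠ y.2 ∧ x.1 = y.1 ∧ x.1 ∈ M) := Iff.rfl

/-- One endpoint of each of the edges joining the two copies of `H`. -/
def transversal {ι : Type*} (m : ι → U) (T : ι → Bool) : Set (U × Bool) :=
  {x | ∃ i, x = (m i, T i)}

/-- Deleting an endpoint of every matching edge disconnects the two copies. If one of these
endpoints is kept, its matching edge survives, and both its ends are reachable from the respective
copies of `e` through unmatched vertices. -/
theorem isMinimalSeparator_transversal {ι : Type*} {H : SimpleGraph U} {m : ι → U}
    (hm : Function.Injective m) {e : U} (he : e ∉ Set.range m)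
    (hconn : PropagatesIn H (Set.range m)ᶜ) (hnbr : ∀ i, ∃ u ∉ Set.range m, H.Adj u (m i))
    (T : ι → Bool) : IsMinimalSeparator (doubled H (Set.range m)) (transversal m T) := by
  have hmem : ∀ u ∉ Set.range m, ∀ b, (u, b) ∉ transversal m T := by
    rintro u hu b ⟨i, hi⟩
    exact hu ⟨i, (congrArg Prod.fst hi).symm⟩
  refine ⟨(e, false), (e, true), by simp, by simp [doubled_adj, he],
    ⟨hmem e he _, hmem e he _, fun hr => ?_⟩, ?_⟩
  · have := reachable_induct hr (fun z => z.1.2 = false) rfl ?_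
    · simp at this
    · rintro ⟨x, hx⟩ ⟨y, hy⟩ hxy hx2
      simp only [comap_adj, Function.Embedding.subtype_apply, doubled_adj] at hxy hx2 ⊢
      rcases hxy with ⟨h1, -⟩ | ⟨h1, h2, i, hi⟩
      · rw [← h1, hx2]
      · exfalso
        cases hTi : T i
        · exact hx ⟨i, Prod.ext hi.symm (by rw [hx2, hTi])⟩
        · refine hy ⟨i, Prod.ext (by rw [← h2, hi]) ?_⟩
          rw [hTi]
          rw [hx2] at h1
          simpa using h1.symm
  · rintro S' hS' hsub x ⟨i, rfl⟩
    by_contra hx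
    obtain ⟨ha, hb, hnr⟩ := hS'
    have hfree : ∀ u ∉ Set.range m, ∀ b, (u, b) ∈ S'ᶜ := fun u hu b h => hmem u hu b (hsub h)
    have hside : ∀ b, ∀ u, (hu : u ∉ Set.range m) →
        ((doubled H (Set.range m)).induce S'ᶜ).Reachable ⟨(e, b), hfree e he b⟩
          ⟨(u, b), hfree u hu b⟩ := by
      intro b u hu
      obtain ⟨_, hr⟩ := hconn (fun u => ∃ hu : u ∉ Set.range m,
        ((doubled H (Set.range m)).induce S'ᶜ).Reachable ⟨(e, b), hfree e he b⟩
          ⟨(u, b), hfree u hu b⟩) ⟨e, he, he, .refl _⟩ (by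
        rintro x _ ⟨hx, hr⟩ y hy hxy
        refine ⟨hy, hr.trans (Adj.reachable ?_)⟩
        simp only [comap_adj, Function.Embedding.subtype_apply, doubled_adj]
        exact Or.inl ⟨trivial, hxy⟩) u hu
      exact hr
    -- A subset of the transversal can contain only the chosen one of the two copies of `m i`, and
    -- that one is missing from `S'`.
    have hmi : ∀ b, (m i, b) ∈ S'ᶜ := by
      intro b hb'
      obtain ⟨j, hj⟩ := hsub hb'
      have hij : i = j := hm (congrArg Prod.fst hj)
      subst hij
      exact hx (hj ▸ hb')
    have hreach : ∀ b, ((doubled H (Set.range m)).induce S'ᶜ).Reachable ⟨(e, b), hfree e he b⟩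
        ⟨(m i, b), hmi b⟩ := by
      intro b
      obtain ⟨u, hu, hadj⟩ := hnbr i
      refine (hside b u hu).trans (Adj.reachable ?_)
      simp only [comap_adj, Function.Embedding.subtype_apply, doubled_adj]
      exact Or.inl ⟨trivial, hadj⟩
    refine hnr ((hreach false).trans (Reachable.trans (Adj.reachable ?_) (hreach true).symm))
    simp only [comap_adj, Function.Embedding.subtype_apply, doubled_adj]
    exact Or.inr ⟨by simp, trivial, i, rfl⟩

theorem transversal_injective {ι : Type*} {m : ι → U} (hm : Function.Injective m) :
    Function.Injective (transversal m) := by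
  intro T T' h
  funext i
  obtain ⟨j, hj⟩ := h.subset ⟨i, rfl⟩
  have hij : i = j := hm (congrArg Prod.fst hj)
  subst hij
  exact congrArg Prod.snd hj

theorem two_pow_le_ncard_minimalSeparators [Finite U] {k : ℕ} {H : SimpleGraph U}
    {m : Fin k → U} (hm : Function.Injective m) {e : U} (he : e ∉ Set.range m)
    (hconn : PropagatesIn H (Set.range m)ᶜ) (hnbr : ∀ i, ∃ u ∉ Set.range m, H.Adj u (m i)) :
    2 ^ k ≤ {S | IsMinimalSeparator (doubled H (Set.range m)) S}.ncard := by
  have hsub : Set.range (transversal m) ⊆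
      {S | IsMinimalSeparator (doubled H (Set.range m)) S} := by
    rintro _ ⟨T, rfl⟩
    exact isMinimalSeparator_transversal hm he hconn hnbr T
  refine le_trans (le_of_eq ?_) (Set.ncard_le_ncard hsub (Set.toFinite _))
  rw [← Set.image_univ, Set.ncard_image_of_injective _ (transversal_injective hm), Set.ncard_univ]
  simp [Nat.card_eq_fintype_card]

end Doubled

-- Substituting the linear vertex count turns the bound into a polynomial in `k`, whose quotient by
-- `2 ^ k` tends to zero.
open Filter Polynomial in
theorem not_tame_of_exponential {𝒢 : Set FinGraph} (c d : ℕ) (G : ℕ → FinGraph)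
    (hG : ∀ k, G k ∈ 𝒢) (hcard : ∀ k, Nat.card (G k).V = c * k + d)
    (hsep : ∀ k, 2 ^ k ≤ numMinSep (G k)) : ¬ Tame 𝒢 := by
  rintro ⟨p, hp⟩
  let q : Polynomial ℝ := p.comp (C (c : ℝ) * X + C (d : ℝ))
  have hq : ∀ k : ℕ, (2 : ℝ) ^ k ≤ q.eval (k : ℝ) := by
    intro k
    have h1 := hp (G k) (hG k)
    rw [hcard] at h1
    have h2 : ((2 : ℝ) ^ k) ≤ (numMinSep (G k) : ℝ) := by exact_mod_cast hsep k
    simpa [q] using h2.trans h1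
  have hlim : Tendsto (fun k : ℕ => q.eval (k : ℝ) / (2 : ℝ) ^ k) atTop (nhds 0) := by
    have hsum : (fun k : ℕ => q.eval (k : ℝ) / (2 : ℝ) ^ k) =
        fun k : ℕ => ∑ i ∈ Finset.range (q.natDegree + 1),
          q.coeff i * ((k : ℝ) ^ i / (2 : ℝ) ^ k) := by
      funext k
      rw [eval_eq_sum_range, Finset.sum_div]
      exact Finset.sum_congr rfl fun i _ => mul_div_assoc _ _ _
    rw [hsum]
    have := tendsto_finsetSum (f := fun i (k : ℕ) => q.coeff i * ((k : ℝ) ^ i / (2 : ℝ) ^ k))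
      (x := atTop) (a := fun i => q.coeff i * 0) (Finset.range (q.natDegree + 1)) fun i _ =>
        (tendsto_pow_const_div_const_pow_of_one_lt i (by norm_num : (1 : ℝ) < 2)).const_mul _
    simpa using this
  obtain ⟨k, hk⟩ := (hlim.eventually (gt_mem_nhds (zero_lt_one' ℝ))).exists
  rw [div_lt_one (by positivity)] at hk
  exact (hq k).not_gt hk

/-! ### Three families with exponentially many minimal separators, and what they do not contain. -/

section Families

/-- The star on `Fin (k + 1)` with centre `0`. -/
def star (k : ℕ) : SimpleGraph (Fin (k + 1)) where
  Adj x y := x ≠ y ∧ (x = 0 ∨ y = 0)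
  symm := ⟨fun _ _ h => ⟨h.1.symm, h.2.symm⟩⟩
  loopless := ⟨fun _ h => h.1 rfl⟩

/-- The path `0, 2, 4, …, 2k` together with a common neighbour `2i + 1` of `2i` and `2i + 2` for
each `i < k`. -/
def triangleChain (k : ℕ) : SimpleGraph (Fin (2 * k + 1)) where
  Adj x y := (x.1 + 1 = y.1 ∨ y.1 + 1 = x.1) ∨
    (x.1 % 2 = 0 ∧ (x.1 + 2 = y.1 ∨ y.1 + 2 = x.1))
  symm := ⟨by intro x y h; omega⟩
  loopless := ⟨by intro x h; omega⟩

/-- Two vertices joined by `k` internally disjoint paths of length three. -/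
def theta (k : ℕ) : FinGraph := ⟨Fin (k + 1) × Bool, doubled (star k) (Set.range Fin.succ)⟩

/-- Two complete graphs on `k + 1` vertices joined by a matching of size `k`. -/
def prism (k : ℕ) : FinGraph :=
  ⟨Fin (k + 1) × Bool, doubled ⊤ (Set.range Fin.succ)⟩

/-- The line graph of a ladder with `k` subdivided rungs. -/
def ladderLineGraph (k : ℕ) : FinGraph :=
  ⟨Fin (2 * k + 1) × Bool, doubled (triangleChain k)
    (Set.range fun i : Fin k => (⟨2 * i.1 + 1, by omega⟩ : Fin (2 * k + 1)))⟩

theorem propagatesIn_compl_range_succ {k : ℕ} (H : SimpleGraph (Fin (k + 1))) :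
    PropagatesIn H (Set.range Fin.succ)ᶜ := by
  rintro p ⟨x, hx, hpx⟩ _ y hy
  simp only [Fin.range_succ, compl_compl, Set.mem_singleton_iff] at hx hy
  rw [hy, ← hx]
  exact hpx

theorem two_pow_le_numMinSep_theta (k : ℕ) : 2 ^ k ≤ numMinSep (theta k) :=
  two_pow_le_ncard_minimalSeparators (Fin.succ_injective k) (e := 0) (by simp)
    (propagatesIn_compl_range_succ _) fun i => ⟨0, by simp, by simp [star, (Fin.succ_ne_zero i).symm]⟩

theorem two_pow_le_numMinSep_prism (k : ℕ) : 2 ^ k ≤ numMinSep (prism k) :=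
  two_pow_le_ncard_minimalSeparators (Fin.succ_injective k) (e := 0) (by simp)
    (propagatesIn_compl_range_succ _) fun i => ⟨0, by simp, by simp [(Fin.succ_ne_zero i).symm]⟩

theorem mem_range_odd_iff {k : ℕ} {x : Fin (2 * k + 1)} :
    x ∈ Set.range (fun i : Fin k => (⟨2 * i.1 + 1, by omega⟩ : Fin (2 * k + 1))) ↔
      x.1 % 2 = 1 := by
  constructor
  · rintro ⟨i, rfl⟩
    simp only
    omega
  · intro h
    exact ⟨⟨x.1 / 2, by omega⟩, Fin.ext (by simp only; omega)⟩

theorem two_pow_le_numMinSep_ladderLineGraph (k : ℕ) : 2 ^ k ≤ numMinSep (ladderLineGraph k) := by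
  refine two_pow_le_ncard_minimalSeparators (e := 0) ?_ ?_ ?_ ?_
  · intro i j h
    simp only [Fin.mk.injEq] at h
    exact Fin.ext (by omega)
  · rw [mem_range_odd_iff]; simp
  · rintro p ⟨x, hx, hpx⟩ hp y hy
    rw [Set.mem_compl_iff, mem_range_odd_iff] at hx hy
    have hp' : ∀ u v : Fin (2 * k + 1), u.1 % 2 = 0 → (u.1 + 2 = v.1 ∨ v.1 + 2 = u.1) → p u →
        p v := by
      intro u v hu huv hpu
      refine hp u ?_ hpu v ?_ (Or.inr ⟨hu, huv⟩) <;> rw [Set.mem_compl_iff, mem_range_odd_iff] <;>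
        omega
    -- The unmatched vertices are the even ones, which form a path; a property is carried down to
    -- `0` and then up to the target.
    have down : ∀ n, ∀ u : Fin (2 * k + 1), u.1 = 2 * n → p u → p 0 := by
      intro n
      induction n with
      | zero => intro u hu hpu; rwa [show u = 0 from Fin.ext (by simpa using hu)] at hpu
      | succ n ih =>
        intro u hu hpu
        exact ih ⟨2 * n, by omega⟩ rfl (hp' u _ (by omega) (Or.inr (by simp only; omega)) hpu)
    have up : ∀ n, ∀ u : Fin (2 * k + 1), u.1 = 2 * n → p 0 → p u := by
      intro n
      induction n with
      | zero => intro u hu hpu; rwa [show u = 0 from Fin.ext (by simpa using hu)]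
      | succ n ih =>
        intro u hu hpu
        exact hp' ⟨2 * n, by omega⟩ u (by simp) (Or.inl (by simp only; omega))
          (ih ⟨2 * n, by omega⟩ rfl hpu)
    exact up (y.1 / 2) y (by omega) (down (x.1 / 2) x (by omega) hpx)
  · intro i
    refine ⟨⟨2 * i.1, by omega⟩, ?_, Or.inl (Or.inl rfl)⟩
    rw [mem_range_odd_iff]
    simp

theorem theta_adj {k : ℕ} {x y : Fin (k + 1) × Bool} : (theta k).graph.Adj x y ↔
    (x.2 = y.2 ∧ x.1 ≠ y.1 ∧ (x.1 = 0 ∨ y.1 = 0)) ∨ (x.2 ≠ y.2 ∧ x.1 = y.1 ∧ x.1 ≠ 0) := by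
  simp [theta, doubled_adj, star]

theorem prism_adj {k : ℕ} {x y : Fin (k + 1) × Bool} : (prism k).graph.Adj x y ↔
    (x.2 = y.2 ∧ x.1 ≠ y.1) ∨ (x.2 ≠ y.2 ∧ x.1 = y.1 ∧ x.1 ≠ 0) := by
  simp [prism, doubled_adj]

theorem ladderLineGraph_adj {k : ℕ} {x y : Fin (2 * k + 1) × Bool} :
    (ladderLineGraph k).graph.Adj x y ↔
      (x.2 = y.2 ∧ ((x.1.1 + 1 = y.1.1 ∨ y.1.1 + 1 = x.1.1) ∨
        (x.1.1 % 2 = 0 ∧ (x.1.1 + 2 = y.1.1 ∨ y.1.1 + 2 = x.1.1)))) ∨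
      (x.2 ≠ y.2 ∧ x.1.1 = y.1.1 ∧ x.1.1 % 2 = 1) := by
  rw [← mem_range_odd_iff, Fin.val_inj]
  rfl

theorem theta_not_triangle {k : ℕ} {x y z : Fin (k + 1) × Bool} (hxy : (theta k).graph.Adj x y)
    (hxz : (theta k).graph.Adj x z) : ¬ (theta k).graph.Adj y z := by
  intro hyz
  rw [theta_adj] at *
  obtain ⟨x, i⟩ := x
  obtain ⟨y, j⟩ := y
  obtain ⟨z, l⟩ := z
  cases i <;> cases j <;> cases l <;> simp at hxy hxz hyz <;> grind

theorem theta_not_fourCycle {k : ℕ} {a b c d : Fin (k + 1) × Bool}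
    (hab : (theta k).graph.Adj a b) (hbc : (theta k).graph.Adj b c)
    (hcd : (theta k).graph.Adj c d) (hda : (theta k).graph.Adj d a) (hac : a ≠ c)
    (hbd : b ≠ d) : False := by
  rw [theta_adj] at hab hbc hcd hda
  obtain ⟨a, i⟩ := a
  obtain ⟨b, j⟩ := b
  obtain ⟨c, l⟩ := c
  obtain ⟨d, m⟩ := d
  cases i <;> cases j <;> cases l <;> cases m <;> simp at hab hbc hcd hda hac hbd <;> grind

theorem theta_not_C4 {k : ℕ} : ¬ C4.graph.IsIndContained (theta k).graph := by
  rintro ⟨f⟩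
  have key : ∀ i j : Fin 4, (cycleGraph 4).Adj i j → (theta k).graph.Adj (f i) (f j) :=
    fun i j h => f.map_rel_iff.2 h
  have inj : ∀ i j : Fin 4, i ≠ j → f i ≠ f j := fun i j h => f.injective.ne h
  exact theta_not_fourCycle (key 0 1 (by decide)) (key 1 2 (by decide)) (key 2 3 (by decide))
    (key 3 0 (by decide)) (inj 0 2 (by decide)) (inj 1 3 (by decide))

theorem prism_not_independent {k : ℕ} {x y z : Fin (k + 1) × Bool} (nxy : x ≠ y) (nxz : x ≠ z)
    (nyz : y ≠ z) (hxy : ¬ (prism k).graph.Adj x y) (hxz : ¬ (prism k).graph.Adj x z) :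
    (prism k).graph.Adj y z := by
  rw [prism_adj] at *
  obtain ⟨x, i⟩ := x
  obtain ⟨y, j⟩ := y
  obtain ⟨z, l⟩ := z
  cases i <;> cases j <;> cases l <;> simp at * <;> grind

/-- Every triangle of the prism lies in one of the two cliques, so triangles sharing an edge lie in
the same one. -/
theorem prism_not_two_triangles {k : ℕ} {a b c d : Fin (k + 1) × Bool}
    (hac : (prism k).graph.Adj a c) (had : (prism k).graph.Adj a d)
    (hbc : (prism k).graph.Adj b c) (hbd : (prism k).graph.Adj b d)
    (hcd : (prism k).graph.Adj c d) (hab : ¬ (prism k).graph.Adj a b) (nab : a ≠ b) : False := by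
  rw [prism_adj] at *
  obtain ⟨a, i⟩ := a
  obtain ⟨b, j⟩ := b
  obtain ⟨c, l⟩ := c
  obtain ⟨d, m⟩ := d
  cases i <;> cases j <;> cases l <;> cases m <;> simp at * <;> grind

theorem prism_not_diamond {k : ℕ} : ¬ diamond.graph.IsIndContained (prism k).graph := by
  rintro ⟨f⟩
  have key : ∀ i j : Fin 4, (i ≠ j ∧ s(i, j) ≠ s(0, 1)) → (prism k).graph.Adj (f i) (f j) :=
    fun i j h => f.map_rel_iff.2 (by simpa [diamond] using h)
  have inj : ∀ i j : Fin 4, i ≠ j → f i ≠ f j := fun i j h => f.injective.ne h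
  exact prism_not_two_triangles (key 0 2 (by decide)) (key 0 3 (by decide)) (key 1 2 (by decide))
    (key 1 3 (by decide)) (key 2 3 (by decide))
    (fun h => absurd (f.map_rel_iff.1 h) (by simp [diamond])) (inj 0 1 (by decide))

/-- The neighbourhood of each vertex is covered by two cliques. -/
theorem ladderLineGraph_adj_of_common_neighbor {k : ℕ} {a b c : Fin (2 * k + 1) × Bool}
    (hab : (ladderLineGraph k).graph.Adj a b) (hac : (ladderLineGraph k).graph.Adj a c)
    (h : (b.2 = a.2 ∧ (a.1.1 % 2 = 1 ∨ b.1.1 < a.1.1)) ↔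
      (c.2 = a.2 ∧ (a.1.1 % 2 = 1 ∨ c.1.1 < a.1.1))) (nbc : b ≠ c) :
    (ladderLineGraph k).graph.Adj b c := by
  -- By `h`, `b` and `c` are in the same clique around `a`: for odd `a`, neighbours in its copy
  -- against the matching partner; for even `a`, smaller indices against larger ones.
  rw [ladderLineGraph_adj] at *
  obtain ⟨a, i⟩ := a
  obtain ⟨b, j⟩ := b
  obtain ⟨c, l⟩ := c
  cases i <;> cases j <;> cases l <;> simp [Fin.ext_iff] at hab hac nbc h ⊢ <;> omega

theorem ladderLineGraph_not_three_independent_neighbors {k : ℕ}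
    {a b c d : Fin (2 * k + 1) × Bool} (hab : (ladderLineGraph k).graph.Adj a b)
    (hac : (ladderLineGraph k).graph.Adj a c) (had : (ladderLineGraph k).graph.Adj a d)
    (hbc : ¬ (ladderLineGraph k).graph.Adj b c) (hbd : ¬ (ladderLineGraph k).graph.Adj b d)
    (hcd : ¬ (ladderLineGraph k).graph.Adj c d) (nbc : b ≠ c) (nbd : b ≠ d) (ncd : c ≠ d) :
    False := by
  have h1 := fun h => hbc (ladderLineGraph_adj_of_common_neighbor hab hac h nbc)
  have h2 := fun h => hbd (ladderLineGraph_adj_of_common_neighbor hab had h nbd)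
  have h3 := fun h => hcd (ladderLineGraph_adj_of_common_neighbor hac had h ncd)
  tauto

theorem ladderLineGraph_not_claw {k : ℕ} :
    ¬ claw.graph.IsIndContained (ladderLineGraph k).graph := by
  rintro ⟨f⟩
  have key : ∀ i : Fin 3, (ladderLineGraph k).graph.Adj (f (Sum.inl 0)) (f (Sum.inr i)) :=
    fun i => f.map_rel_iff.2 (by simp [claw])
  have key' : ∀ i j : Fin 3, ¬ (ladderLineGraph k).graph.Adj (f (Sum.inr i)) (f (Sum.inr j)) :=
    fun i j h => absurd (f.map_rel_iff.1 h) (by simp [claw])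
  have inj : ∀ i j : Fin 3, i ≠ j → f (Sum.inr i) ≠ f (Sum.inr j) :=
    fun i j h => f.injective.ne (fun e => h (Sum.inr_injective e))
  exact ladderLineGraph_not_three_independent_neighbors (key 0) (key 1) (key 2) (key' 0 1)
    (key' 0 2) (key' 1 2) (inj 0 1 (by decide)) (inj 0 2 (by decide)) (inj 1 2 (by decide))

theorem ladderLineGraph_not_inducedFourCycle {k : ℕ} {a b c d : Fin (2 * k + 1) × Bool}
    (hab : (ladderLineGraph k).graph.Adj a b) (hbc : (ladderLineGraph k).graph.Adj b c)
    (hcd : (ladderLineGraph k).graph.Adj c d) (hda : (ladderLineGraph k).graph.Adj d a)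
    (hac : ¬ (ladderLineGraph k).graph.Adj a c) (hbd : ¬ (ladderLineGraph k).graph.Adj b d)
    (nac : a ≠ c) (nbd : b ≠ d) : False := by
  rw [ladderLineGraph_adj] at hab hbc hcd hda hac hbd
  obtain ⟨a, i⟩ := a
  obtain ⟨b, j⟩ := b
  obtain ⟨c, l⟩ := c
  obtain ⟨d, m⟩ := d
  cases i <;> cases j <;> cases l <;> cases m <;>
    simp [Fin.ext_iff] at hab hbc hcd hda hac hbd nac nbd <;> omega

theorem ladderLineGraph_not_C4 {k : ℕ} :
    ¬ C4.graph.IsIndContained (ladderLineGraph k).graph := by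
  rintro ⟨f⟩
  have key : ∀ i j : Fin 4, (cycleGraph 4).Adj i j → (ladderLineGraph k).graph.Adj (f i) (f j) :=
    fun i j h => f.map_rel_iff.2 h
  have key' : ∀ i j : Fin 4, ¬ (cycleGraph 4).Adj i j →
      ¬ (ladderLineGraph k).graph.Adj (f i) (f j) := fun i j h h' => h (f.map_rel_iff.1 h')
  have inj : ∀ i j : Fin 4, i ≠ j → f i ≠ f j := fun i j h => f.injective.ne h
  exact ladderLineGraph_not_inducedFourCycle (key 0 1 (by decide)) (key 1 2 (by decide))
    (key 2 3 (by decide)) (key 3 0 (by decide)) (key' 0 2 (by decide)) (key' 1 3 (by decide))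
    (inj 0 2 (by decide)) (inj 1 3 (by decide))

/-- Nothing is assumed about adjacency of `a` and `b`, so this excludes `K₄` as well as the diamond.
-/
theorem ladderLineGraph_not_two_triangles {k : ℕ} {a b c d : Fin (2 * k + 1) × Bool}
    (hac : (ladderLineGraph k).graph.Adj a c) (had : (ladderLineGraph k).graph.Adj a d)
    (hbc : (ladderLineGraph k).graph.Adj b c) (hbd : (ladderLineGraph k).graph.Adj b d)
    (hcd : (ladderLineGraph k).graph.Adj c d) (nab : a ≠ b) : False := by
  rw [ladderLineGraph_adj] at hac had hbc hbd hcd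
  obtain ⟨a, i⟩ := a
  obtain ⟨b, j⟩ := b
  obtain ⟨c, l⟩ := c
  obtain ⟨d, m⟩ := d
  cases i <;> cases j <;> cases l <;> cases m <;>
    simp [Fin.ext_iff] at hac had hbc hbd hcd nab <;> omega

end Families

/-! ### Which four-vertex graphs the families allow, and the resulting elimination. -/

section Dichotomy

theorem isIndContained_theta_triangle_free {k : ℕ} {H : FinGraph}
    (h : H.graph.IsIndContained (theta k).graph) {x y z : H.V} (hxy : H.graph.Adj x y)
    (hxz : H.graph.Adj x z) (hyz : H.graph.Adj y z) : False := by
  obtain ⟨f⟩ := h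
  exact theta_not_triangle (f.map_rel_iff.2 hxy) (f.map_rel_iff.2 hxz) (f.map_rel_iff.2 hyz)

theorem isIndContained_prism_not_independent {k : ℕ} {H : FinGraph}
    (h : H.graph.IsIndContained (prism k).graph) {x y z : H.V} (hxy : ¬ H.graph.Adj x y)
    (hxz : ¬ H.graph.Adj x z) (hyz : ¬ H.graph.Adj y z) (nxy : x ≠ y) (nxz : x ≠ z)
    (nyz : y ≠ z) : False := by
  obtain ⟨f⟩ := h
  exact hyz (f.map_rel_iff.1 (prism_not_independent (f.injective.ne nxy) (f.injective.ne nxz)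
    (f.injective.ne nyz) (fun h => hxy (f.map_rel_iff.1 h)) (fun h => hxz (f.map_rel_iff.1 h))))

theorem isIndContained_ladderLineGraph_not_two_triangles {k : ℕ} {H : FinGraph}
    (h : H.graph.IsIndContained (ladderLineGraph k).graph) {a b c d : H.V}
    (hac : H.graph.Adj a c) (had : H.graph.Adj a d) (hbc : H.graph.Adj b c)
    (hbd : H.graph.Adj b d) (hcd : H.graph.Adj c d) (nab : a ≠ b) : False := by
  obtain ⟨f⟩ := h
  exact ladderLineGraph_not_two_triangles (f.map_rel_iff.2 hac) (f.map_rel_iff.2 had)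
    (f.map_rel_iff.2 hbc) (f.map_rel_iff.2 hbd) (f.map_rel_iff.2 hcd) (f.injective.ne nab)

theorem mem_of_isIndContained_theta {k : ℕ} {H : FinGraph} (hH : H ∈ fourVertexGraphs)
    (h : H.graph.IsIndContained (theta k).graph) :
    H ∈ ({P4, twoP2, fourP1, P2add2P1, P3addP1, claw} : Set FinGraph) := by
  rcases hH with rfl | rfl | rfl | rfl | rfl | rfl | rfl | rfl | rfl | rfl | rfl <;>
    try (simp; done)
  · exact (isIndContained_theta_triangle_free h (x := Sum.inl 0) (y := Sum.inl 1) (z := Sum.inl 2)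
      (by simp [K3addP1]) (by simp [K3addP1]) (by simp [K3addP1])).elim
  · exact (theta_not_C4 h).elim
  · exact (isIndContained_theta_triangle_free h (x := (0 : Fin 4)) (y := (1 : Fin 4))
      (z := (2 : Fin 4)) (by simp [paw]) (by simp [paw]) (by simp [paw])).elim
  · exact (isIndContained_theta_triangle_free h (x := (0 : Fin 4)) (y := (2 : Fin 4))
      (z := (3 : Fin 4)) (by simp [diamond]) (by simp [diamond]) (by simp [diamond])).elim
  · exact (isIndContained_theta_triangle_free h (x := (0 : Fin 4)) (y := (1 : Fin 4))
      (z := (2 : Fin 4)) (by simp [K4]) (by simp [K4]) (by simp [K4])).elim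

theorem mem_of_isIndContained_prism {k : ℕ} {H : FinGraph} (hH : H ∈ fourVertexGraphs)
    (h : H.graph.IsIndContained (prism k).graph) :
    H ∈ ({P4, twoP2, K3addP1, paw, C4, K4} : Set FinGraph) := by
  rcases hH with rfl | rfl | rfl | rfl | rfl | rfl | rfl | rfl | rfl | rfl | rfl <;>
    try (simp; done)
  · exact (isIndContained_prism_not_independent h (x := (0 : Fin 4)) (y := (1 : Fin 4))
      (z := (2 : Fin 4)) (by simp [fourP1]) (by simp [fourP1]) (by simp [fourP1])
      (show (0 : Fin 4) ≠ 1 by decide) (show (0 : Fin 4) ≠ 2 by decide)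
      (show (1 : Fin 4) ≠ 2 by decide)).elim
  · exact (isIndContained_prism_not_independent h (x := Sum.inl 0) (y := Sum.inr 0)
      (z := Sum.inr 1) (by simp [P2add2P1]) (by simp [P2add2P1]) (by simp [P2add2P1])
      Sum.inl_ne_inr Sum.inl_ne_inr (Sum.inr_injective.ne (by decide))).elim
  · exact (isIndContained_prism_not_independent h (x := Sum.inl 0) (y := Sum.inl 2)
      (z := Sum.inr 0) (by simp [P3addP1, pathGraph_adj]) (by simp [P3addP1]) (by simp [P3addP1])
      (Sum.inl_injective.ne (by decide)) Sum.inl_ne_inr Sum.inl_ne_inr).elim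
  · exact (isIndContained_prism_not_independent h (x := Sum.inr 0) (y := Sum.inr 1)
      (z := Sum.inr 2) (by simp [claw]) (by simp [claw]) (by simp [claw])
      (Sum.inr_injective.ne (by decide)) (Sum.inr_injective.ne (by decide))
      (Sum.inr_injective.ne (by decide))).elim
  · exact (prism_not_diamond h).elim

theorem mem_of_isIndContained_ladderLineGraph {k : ℕ} {H : FinGraph} (hH : H ∈ fourVertexGraphs)
    (h : H.graph.IsIndContained (ladderLineGraph k).graph) :
    H ∈ ({P4, twoP2, fourP1, P2add2P1, P3addP1, K3addP1, paw} : Set FinGraph) := by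
  rcases hH with rfl | rfl | rfl | rfl | rfl | rfl | rfl | rfl | rfl | rfl | rfl <;>
    try (simp; done)
  · exact (ladderLineGraph_not_claw h).elim
  · exact (ladderLineGraph_not_C4 h).elim
  · exact (isIndContained_ladderLineGraph_not_two_triangles h (a := (0 : Fin 4)) (b := (1 : Fin 4))
      (c := (2 : Fin 4)) (d := (3 : Fin 4)) (by simp [diamond]) (by simp [diamond])
      (by simp [diamond]) (by simp [diamond]) (by simp [diamond])
      (show (0 : Fin 4) ≠ 1 by decide)).elim
  · exact (isIndContained_ladderLineGraph_not_two_triangles h (a := (0 : Fin 4)) (b := (1 : Fin 4))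
      (c := (2 : Fin 4)) (d := (3 : Fin 4)) (by simp [K4]) (by simp [K4])
      (by simp [K4]) (by simp [K4]) (by simp [K4])
      (show (0 : Fin 4) ≠ 1 by decide)).elim

/-- If the `ℱ`-free graphs are tame, then a family of graphs with exponentially many minimal
separators has a four-vertex induced subgraph that contains a member of `ℱ`. -/
theorem exists_fourVertexGraph_of_tame {ℱ : Set FinGraph} (hcard : ∀ F ∈ ℱ, Nat.card F.V ≤ 4)
    (ht : Tame (freeClass ℱ)) (c d : ℕ) (hd : 4 ≤ d) (G : ℕ → FinGraph)
    (hG : ∀ k, Nat.card (G k).V = c * k + d) (hsep : ∀ k, 2 ^ k ≤ numMinSep (G k)) :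
    ∃ k, ∃ H ∈ fourVertexGraphs, (∃ F ∈ ℱ, F.graph.IsIndContained H.graph) ∧
      H.graph.IsIndContained (G k).graph := by
  by_contra! hcon
  refine not_tame_of_exponential (𝒢 := freeClass ℱ) c d G (fun k F hF hFG => ?_) hG hsep ht
  -- The bound `4 ≤ d` leaves room in every `G k` to enlarge the copy of `F` to four vertices.
  obtain ⟨H, hH, h1, h2⟩ := exists_fourVertexGraph_between hFG (hcard F hF)
    (by rw [hG]; omega)
  exact hcon k H hH ⟨F, hF, h1⟩ h2

/-- A graph without isolated vertices cannot use the isolated vertices of the sum. Hence padding a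
small graph with them never creates a claw or a `C₄`. -/
theorem card_le_of_isIndContained_sum_bot {V W ι : Type*} [Finite V] {H : SimpleGraph W}
    {F : SimpleGraph V} (hH : ∀ x, ∃ y, H.Adj x y)
    (h : H.IsIndContained (SimpleGraph.sum F (⊥ : SimpleGraph ι))) :
    Nat.card W ≤ Nat.card V := by
  obtain ⟨f⟩ := h
  have hinl : ∀ x, ∃ v, f x = Sum.inl v := by
    intro x
    obtain ⟨y, hxy⟩ := hH x
    have hadj := f.map_rel_iff.2 hxy
    rcases hx : f x with v | i
    · exact ⟨v, rfl⟩
    · rw [hx] at hadj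
      rcases hy : f y with w | j <;> rw [hy] at hadj <;> simp at hadj
  choose g hg using hinl
  refine Nat.card_le_card_of_injective g fun x y hxy => f.injective ?_
  rw [hg, hg, hxy]

theorem isIndContained_P2add2P1_of_edgeless {F : FinGraph}
    (h : F.graph.IsIndContained fourP1.graph) (hc : Nat.card F.V ≤ 3) :
    F.graph.IsIndContained P2add2P1.graph := by
  obtain ⟨f⟩ := h
  have hno : ∀ x y, ¬ F.graph.Adj x y := fun x y hxy => by
    simpa [fourP1] using f.map_rel_iff.2 hxy
  have := Fintype.ofFinite F.V
  obtain ⟨g⟩ : Nonempty (F.V ↪ Fin 3) :=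
    Function.Embedding.nonempty_of_card_le (by simpa [Nat.card_eq_fintype_card] using hc)
  let w : Fin 3 → Fin 2 ⊕ Fin 2 := ![Sum.inl 0, Sum.inr 0, Sum.inr 1]
  have hw : ∀ i j : Fin 3, i ≠ j → w i ≠ w j := by decide
  have hw' : ∀ i j : Fin 3, ¬ P2add2P1.graph.Adj (w i) (w j) := by
    intro i j
    fin_cases i <;> fin_cases j <;> simp [w, P2add2P1]
  exact isIndContained_of_map (fun x => w (g x)) fun x y hxy =>
    ⟨hw _ _ (g.injective.ne hxy), iff_of_false (hw' _ _) (hno x y)⟩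

/-- Padding `F` with four isolated vertices makes room for a four-vertex extension `H`. If `H` is
`4P₁`, the claw or `C₄` but `F` has at most three vertices, then `H` has an isolated vertex, so `H`
is `4P₁` and the edgeless `F` embeds in `P₂ + 2P₁`. -/
theorem isIndContained_or_iso {F : FinGraph} (hF : Nat.card F.V ≤ 4) :
    (∃ H ∈ ({P4, twoP2, P2add2P1, P3addP1, K3addP1, paw, diamond, K4} : Set FinGraph),
      F.graph.IsIndContained H.graph) ∨
    ∃ H ∈ ({fourP1, claw, C4} : Set FinGraph), Nonempty (F.graph ≃g H.graph) := by
  obtain ⟨H, hH, hFH, hHF⟩ := exists_fourVertexGraph_between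
    (G := SimpleGraph.sum F.graph (⊥ : SimpleGraph (Fin 4))) ⟨Embedding.sumInl⟩ hF
    (by rw [Nat.card_sum]; simp)
  have hsplit : H ∈ ({P4, twoP2, P2add2P1, P3addP1, K3addP1, paw, diamond, K4} : Set FinGraph) ∨
      H ∈ ({fourP1, claw, C4} : Set FinGraph) := by
    rcases hH with rfl | rfl | rfl | rfl | rfl | rfl | rfl | rfl | rfl | rfl | rfl <;> simp
  rcases hsplit with hH' | hH'
  · exact Or.inl ⟨H, hH', hFH⟩
  by_cases hc : Nat.card F.V = 4
  · exact Or.inr ⟨H, hH', exists_iso_of_card_eq hFH (by rw [hc, card_of_mem_fourVertexGraphs hH])⟩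
  · have hc3 : Nat.card F.V ≤ 3 := by omega
    have hlt : ¬ Nat.card H.V ≤ Nat.card F.V := by rw [card_of_mem_fourVertexGraphs hH]; omega
    rcases hH' with rfl | rfl | rfl
    · exact Or.inl ⟨P2add2P1, by simp, isIndContained_P2add2P1_of_edgeless hFH hc3⟩
    · refine absurd (card_le_of_isIndContained_sum_bot ?_ hHF) hlt
      rintro (x | x)
      · exact ⟨Sum.inr 0, by simp [claw]⟩
      · exact ⟨Sum.inl 0, by simp [claw]⟩
    · refine absurd (card_le_of_isIndContained_sum_bot ?_ hHF) hlt
      exact (by decide : ∀ x : Fin 4, ∃ y, (cycleGraph 4).Adj x y)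

theorem freeLE_of_forall {ℱ ℱ' : Set FinGraph}
    (h : ∀ X ∈ ℱ', ∃ F ∈ ℱ, F.graph.IsIndContained X.graph) : FreeLE ℱ ℱ' := by
  intro G hG X hX hXG
  obtain ⟨F, hF, hFX⟩ := h X hX
  exact hG F hF (hFX.trans hXG)

theorem exists_listed_of_tame {ℱ : Set FinGraph} (hcard : ∀ F ∈ ℱ, Nat.card F.V ≤ 4)
    (h₁ : ¬ SameFamily ℱ {fourP1, C4}) (h₂ : ¬ SameFamily ℱ {fourP1, claw, C4})
    (ht : Tame (freeClass ℱ)) : ∃ ℱ', IsListed ℱ' ∧ FreeLE ℱ ℱ' := by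
  -- The index is shifted to `k + 1` so that even the first graph of each sequence has at least four
  -- vertices.
  obtain ⟨k₁, H₁, hH₁, hF₁, hG₁⟩ := exists_fourVertexGraph_of_tame hcard ht 2 4 le_rfl
    (fun k => theta (k + 1)) (fun k => by simp [theta]; ring) fun k =>
      (Nat.pow_le_pow_right (by norm_num) k.le_succ).trans (two_pow_le_numMinSep_theta (k + 1))
  obtain ⟨k₂, H₂, hH₂, hF₂, hG₂⟩ := exists_fourVertexGraph_of_tame hcard ht 2 4 le_rfl
    (fun k => prism (k + 1)) (fun k => by simp [prism]; ring) fun k =>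
      (Nat.pow_le_pow_right (by norm_num) k.le_succ).trans (two_pow_le_numMinSep_prism (k + 1))
  obtain ⟨k₃, H₃, hH₃, hF₃, hG₃⟩ := exists_fourVertexGraph_of_tame hcard ht 4 6 (by norm_num)
    (fun k => ladderLineGraph (k + 1)) (fun k => by simp [ladderLineGraph]; ring) fun k =>
      (Nat.pow_le_pow_right (by norm_num) k.le_succ).trans
        (two_pow_le_numMinSep_ladderLineGraph (k + 1))
  replace hG₁ := mem_of_isIndContained_theta hH₁ hG₁
  replace hG₂ := mem_of_isIndContained_prism hH₂ hG₂
  replace hG₃ := mem_of_isIndContained_ladderLineGraph hH₃ hG₃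
  by_contra hcon
  -- `L X` makes every `ℱ`-free graph `X`-free, so by `hcon` it fails for some member of every
  -- listed family.
  let L : FinGraph → Prop := fun X => ∃ F ∈ ℱ, F.graph.IsIndContained X.graph
  have no : ∀ ℱ', IsListed ℱ' → ¬ ∀ X ∈ ℱ', L X :=
    fun ℱ' hl h => hcon ⟨ℱ', hl, freeLE_of_forall h⟩
  have no2 : ∀ X Y, IsListed {X, Y} → L X → ¬ L Y := fun X Y hl hX hY => no _ hl (by
    rintro Z (rfl | rfl) <;> assumption)
  have nP4 : ¬ L P4 := fun h => no {P4} (Or.inl (Or.inl rfl)) (by rintro _ rfl; exact h)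
  have n2P2 : ¬ L twoP2 := fun h => no {twoP2} (Or.inl (Or.inr rfl)) (by rintro _ rfl; exact h)
  have npaw : ∀ X ∈ ({fourP1, P2add2P1, P3addP1, claw} : Set FinGraph), L X → ¬ L paw :=
    fun X hX => no2 X paw (Or.inr (Or.inl ⟨X, hX, rfl⟩))
  have nK3 : ∀ X ∈ ({fourP1, P2add2P1, P3addP1, claw} : Set FinGraph), L X → ¬ L K3addP1 :=
    fun X hX => no2 X K3addP1 (Or.inr (Or.inr (Or.inl ⟨X, hX, rfl⟩)))
  have nK4 : ∀ X ∈ ({fourP1, P2add2P1, P3addP1} : Set FinGraph), L X → ¬ L K4 :=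
    fun X hX => no2 X K4 (Or.inr (Or.inr (Or.inr (Or.inl ⟨X, hX, rfl⟩))))
  have nC4 : ∀ X ∈ ({P2add2P1, P3addP1} : Set FinGraph), L X → ¬ L C4 :=
    fun X hX => no2 X C4 (Or.inr (Or.inr (Or.inr (Or.inr (Or.inl ⟨X, hX, rfl⟩)))))
  have ndiamond : L fourP1 → L C4 → ¬ L diamond := fun h1 h2 h3 =>
    no {fourP1, C4, diamond} (Or.inr (Or.inr (Or.inr (Or.inr (Or.inr rfl))))) (by
      rintro Z (rfl | rfl | rfl) <;> assumption)
  simp only [Set.mem_insert_iff, Set.mem_singleton_iff, forall_eq_or_imp, forall_eq]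
    at npaw nK3 nK4 nC4
  have hL₁ : L fourP1 ∨ L P2add2P1 ∨ L P3addP1 ∨ L claw := by
    rcases hG₁ with rfl | rfl | rfl | rfl | rfl | rfl
    exacts [(nP4 hF₁).elim, (n2P2 hF₁).elim, Or.inl hF₁, Or.inr (Or.inl hF₁),
      Or.inr (Or.inr (Or.inl hF₁)), Or.inr (Or.inr (Or.inr hF₁))]
  have npaw' : ¬ L paw := fun h => by
    rcases hL₁ with h1 | h1 | h1 | h1
    exacts [npaw.1 h1 h, npaw.2.1 h1 h, npaw.2.2.1 h1 h, npaw.2.2.2 h1 h]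
  have nK3' : ¬ L K3addP1 := fun h => by
    rcases hL₁ with h1 | h1 | h1 | h1
    exacts [nK3.1 h1 h, nK3.2.1 h1 h, nK3.2.2.1 h1 h, nK3.2.2.2 h1 h]
  have hL₂ : L C4 ∨ L K4 := by
    rcases hG₂ with rfl | rfl | rfl | rfl | rfl | rfl
    exacts [(nP4 hF₂).elim, (n2P2 hF₂).elim, (nK3' hF₂).elim, (npaw' hF₂).elim, Or.inl hF₂,
      Or.inr hF₂]
  have hL₃ : L fourP1 ∨ L P2add2P1 ∨ L P3addP1 := by
    rcases hG₃ with rfl | rfl | rfl | rfl | rfl | rfl | rfl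
    exacts [(nP4 hF₃).elim, (n2P2 hF₃).elim, Or.inl hF₃, Or.inr (Or.inl hF₃),
      Or.inr (Or.inr hF₃), (nK3' hF₃).elim, (npaw' hF₃).elim]
  have nK4' : ¬ L K4 := fun h => by
    rcases hL₃ with h1 | h1 | h1
    exacts [nK4.1 h1 h, nK4.2.1 h1 h, nK4.2.2 h1 h]
  have hC4 : L C4 := hL₂.resolve_right nK4'
  have nP2' : ¬ L P2add2P1 := fun h => nC4.1 h hC4
  have nP3' : ¬ L P3addP1 := fun h => nC4.2 h hC4
  have h4P1 : L fourP1 := hL₃.resolve_right (not_or.2 ⟨nP2', nP3'⟩)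
  have ndiamond' := ndiamond h4P1 hC4
  have hiso : ∀ F ∈ ℱ, ∃ H ∈ ({fourP1, claw, C4} : Set FinGraph),
      Nonempty (F.graph ≃g H.graph) := by
    intro F hF
    refine (isIndContained_or_iso (hcard F hF)).resolve_left ?_
    rintro ⟨H, hH, hFH⟩
    have hLH : L H := ⟨F, hF, hFH⟩
    rcases hH with rfl | rfl | rfl | rfl | rfl | rfl | rfl | rfl
    exacts [nP4 hLH, n2P2 hLH, nP2' hLH, nP3' hLH, nK3' hLH, npaw' hLH, ndiamond' hLH, nK4' hLH]
  have hcard4 : ∀ F ∈ ℱ, Nat.card F.V = 4 := by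
    intro F hF
    obtain ⟨H, hH, ⟨e⟩⟩ := hiso F hF
    rw [Nat.card_congr e.toEquiv]
    refine card_of_mem_fourVertexGraphs ?_
    rcases hH with rfl | rfl | rfl <;> simp [fourVertexGraphs]
  -- All members of `ℱ` now have exactly four vertices, so embedding in a four-vertex graph means
  -- being isomorphic to it.
  have exact_of : ∀ X ∈ fourVertexGraphs, L X → ∃ F ∈ ℱ, Nonempty (F.graph ≃g X.graph) := by
    rintro X hX ⟨F, hF, hFX⟩
    exact ⟨F, hF, exists_iso_of_card_eq hFX (by rw [hcard4 F hF, card_of_mem_fourVertexGraphs hX])⟩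
  have e1 := exact_of fourP1 (by simp [fourVertexGraphs]) h4P1
  have e2 := exact_of C4 (by simp [fourVertexGraphs]) hC4
  by_cases hclaw : ∃ F ∈ ℱ, Nonempty (F.graph ≃g claw.graph)
  · refine h₂ ⟨hiso, ?_⟩
    rintro H (rfl | rfl | rfl) <;> assumption
  · refine h₁ ⟨fun F hF => ?_, ?_⟩
    · obtain ⟨H, rfl | rfl | rfl, hFH⟩ := hiso F hF
      · exact ⟨_, by simp, hFH⟩
      · exact (hclaw ⟨F, hF, hFH⟩).elim
      · exact ⟨_, by simp, hFH⟩
    · rintro H (rfl | rfl) <;> assumption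

end Dichotomy
end MinSep

theorem theorem1 (ℱ : Set MinSep.FinGraph)
    (hcard : ∀ F ∈ ℱ, Nat.card F.V ≤ 4)
    (h₁ : ¬ MinSep.SameFamily ℱ {MinSep.fourP1, MinSep.C4})
    (h₂ : ¬ MinSep.SameFamily ℱ {MinSep.fourP1, MinSep.claw, MinSep.C4}) :
    MinSep.Tame (MinSep.freeClass ℱ) ↔
      ∃ ℱ' : Set MinSep.FinGraph, MinSep.IsListed ℱ' ∧ MinSep.FreeLE ℱ ℱ' := by
  refine ⟨MinSep.exists_listed_of_tame hcard h₁ h₂, ?_⟩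
  rintro ⟨ℱ', hl, hle⟩
  exact hl.tame.mono hle
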